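/- Fix a real number $q>2$ and put $\lambda_c = 2\left(\frac{q-1}{q-2}\right)\ln(q-1)$ and $\lambda=\lambda_c+(q-\lambda_c)/2$. There is a real number $N_0$, depending only on $q$, such that the following holds. Let $K$ and $T$ be disjoint finite sets with $N=|K|$ and $t=|T|>1$, let $0<\eta<1$, and suppose that $N\ge\max\{t^{16},\,\eta^{-8},\,N_0\}$. Let $\rho$ be any real number with $N^{-3}\le\rho\le\lambda/N$. Let $\Gamma$ be the complete graph with vertex set $V=K\cup T$ and edge set $E$, and give each edge $e$ of $\Gamma$ the value $$p(e)=\begin{cases}\rho,&\text{if both endpoints of }e\text{ are in }K,\\ N^{-3/4},&\text{if one endpoint of }e\text{ is in }K\text{ and the other is in }T,\\ 1,&\text{if both endpoints of }e\text{ are in }T.\end{cases}$$ Let $A\subseteq E$ be drawn from the random cluster model on $\Gamma$, in which each $A\subseteq E$ has probability proportional to $q^{\kappa(V,A)}\prod_{e\in A}p(e)\prod_{e\in E\setminus A}(1-p(e))$, where $\kappa(V,A)$ is the number of connected components of the graph $(V,A)$. Let $Y(A)$ be the number of connected components that contain at least one element of $T$ in the graph with vertex set $V$ and edge set obtained from $A$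 by deleting all edges with both endpoints in $T$. Then $$\Pr(1<Y(A)<t)<\eta.$$ -/

import Mathlib

/-! ### The random cluster model on a finite graph -/

/-- `κ(V, A)`: the number of connected components of the graph with vertex set `V` and
edge set `A`. -/
noncomputable def numComponents {V : Type*} (A : Finset (Sym2 V)) : ℕ :=
  Nat.card (SimpleGraph.fromEdgeSet (A : Set (Sym2 V))).ConnectedComponent

open Classical in
/-- The set of edges of a finite graph, as a finite set. -/
noncomputable def edges {V : Type*} [Fintype V] (G : SimpleGraph V) : Finset (Sym2 V) :=
  {e | e ∈ G.edgeSet}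

open Classical in
/-- The random cluster weight
`q ^ κ(V, A) * ∏_{e ∈ A} p(e) * ∏_{e ∈ E \ A} (1 - p(e))` of an edge subset `A ⊆ E`. -/
noncomputable def rcWeight {V : Type*} [Fintype V] (G : SimpleGraph V) (q : ℝ)
    (p : Sym2 V → ℝ) (A : Finset (Sym2 V)) : ℝ :=
  q ^ numComponents A * (∏ e ∈ A, p e) * ∏ e ∈ edges G \ A, (1 - p e)

/-- The random cluster partition function: the sum of the weights over all `A ⊆ E`. -/
noncomputable def rcPartition {V : Type*} [Fintype V] (G : SimpleGraph V) (q : ℝ)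
    (p : Sym2 V → ℝ) : ℝ :=
  ∑ A ∈ (edges G).powerset, rcWeight G q p A

/-- The probability of the single configuration `A ⊆ E` in the random cluster model. -/
noncomputable def rcProb {V : Type*} [Fintype V] (G : SimpleGraph V) (q : ℝ)
    (p : Sym2 V → ℝ) (A : Finset (Sym2 V)) : ℝ :=
  rcWeight G q p A / rcPartition G q p

open Classical in
/-- The probability that `S A` holds when `A` is drawn from the random cluster model. -/
noncomputable def rcPr {V : Type*} [Fintype V] (G : SimpleGraph V) (q : ℝ)
    (p : Sym2 V → ℝ) (S : Finset (Sym2 V) → Prop) : ℝ :=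
  ∑ A ∈ (edges G).powerset with S A, rcProb G q p A

/-- The weights are non-negative for edge probabilities in `[0, 1]`. -/
theorem rcWeight_nonneg {V : Type*} [Fintype V] (G : SimpleGraph V) {q : ℝ} (hq : 0 < q)
    {p : Sym2 V → ℝ} (hp : ∀ e, p e ∈ Set.Icc (0 : ℝ) 1) (A : Finset (Sym2 V)) :
    0 ≤ rcWeight G q p A := by
  unfold rcWeight
  refine mul_nonneg (mul_nonneg (by positivity) (Finset.prod_nonneg fun e _ => (hp e).1))
    (Finset.prod_nonneg fun e _ => sub_nonneg.2 (hp e).2)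

open Classical in
/-- The partition function is positive, so the division in `rcProb` is a genuine one. -/
theorem rcPartition_pos {V : Type*} [Fintype V] (G : SimpleGraph V) {q : ℝ} (hq : 0 < q)
    {p : Sym2 V → ℝ} (hp : ∀ e, p e ∈ Set.Icc (0 : ℝ) 1) : 0 < rcPartition G q p := by
  unfold rcPartition
  refine Finset.sum_pos' (fun A _ => rcWeight_nonneg G hq hp A)
    ⟨(edges G).filter (fun e => p e = 1), by simp, ?_⟩
  unfold rcWeight
  refine mul_pos (mul_pos (by positivity) (Finset.prod_pos fun e he => ?_))
    (Finset.prod_pos fun e he => ?_)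
  · rw [(Finset.mem_filter.1 he).2]; exact one_pos
  · have h1 : p e ≠ 1 := fun h => by
      simp only [Finset.mem_sdiff, Finset.mem_filter] at he
      exact he.2 ⟨he.1, h⟩
    exact sub_pos.2 (lt_of_le_of_ne (hp e).2 h1)

/-- The random cluster probabilities add up to one. -/
theorem rcPr_true {V : Type*} [Fintype V] (G : SimpleGraph V) {q : ℝ} (hq : 0 < q)
    {p : Sym2 V → ℝ} (hp : ∀ e, p e ∈ Set.Icc (0 : ℝ) 1) : rcPr G q p (fun _ => True) = 1 := by
  have h := (rcPartition_pos G hq hp).ne'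
  simp only [rcPr, rcProb, Finset.filter_true, ← Finset.sum_div]
  exact div_self h

/-! ### The critical value -/

/-- `λ_c = 2 ((q - 1) / (q - 2)) ln (q - 1)`. -/
noncomputable def lambdaC (q : ℝ) : ℝ := 2 * ((q - 1) / (q - 2)) * Real.log (q - 1)

/-- `λ = λ_c + (q - λ_c) / 2`. -/
noncomputable def gadgetLambda (q : ℝ) : ℝ := lambdaC q + (q - lambdaC q) / 2

/-! ### The gadget

The gadget is the complete graph on the disjoint union `K ⊕ T`, where the elements of `T` are
the terminals. -/

/-- The edge probabilities of the gadget: `ρ` inside `K`, `|K| ^ (-3/4)` between `K` and `T`,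
and `1` inside `T`. -/
noncomputable def gadgetP (K T : Type*) [Fintype K] (ρ : ℝ) : Sym2 (K ⊕ T) → ℝ :=
  Sym2.lift ⟨fun x y =>
    match x, y with
    | Sum.inl _, Sum.inl _ => ρ
    | Sum.inl _, Sum.inr _ => (Fintype.card K : ℝ) ^ (-(3 / 4) : ℝ)
    | Sum.inr _, Sum.inl _ => (Fintype.card K : ℝ) ^ (-(3 / 4) : ℝ)
    | Sum.inr _, Sum.inr _ => 1,
    by rintro (x | x) (y | y) <;> rfl⟩

/-- `T^(2)`: the unordered pairs of distinct terminals. -/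
def terminalPairs (K T : Type*) : Set (Sym2 (K ⊕ T)) :=
  {e | ∃ u v : T, u ≠ v ∧ e = s(Sum.inr u, Sum.inr v)}

/-- `Y(A)`: the number of connected components of the graph `(K ∪ T, A \ T^(2))` that contain
a terminal. -/
noncomputable def gadgetY {K T : Type*} (A : Finset (Sym2 (K ⊕ T))) : ℕ :=
  {c : (SimpleGraph.fromEdgeSet ((A : Set (Sym2 (K ⊕ T))) \ terminalPairs K T)).ConnectedComponent |
    ∃ v : T, Sum.inr v ∈ c.supp}.ncard

/-! Write N = |K|, t = |T|, u = N^(1/16), c = N^(-3/4). All terminals are joined by certain edges,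
so a component of (V, A) either contains T or is a component D of the graph B on K that sends no
edge to T. Summing out the edges between K and T gives B its binomial weight times ∏_D (1 +
(q-1)s^|D|), where s = (1-c)^t (`numComponents_config`, `bernSum_prod_attachWeight`).

`rcPr_gadgetY_le` splits by the component sizes of B. A component of size linear in N touches every
terminal, which forces Y ≤ 1, except with probability exponentially small in u. If all components
have at most u^2 vertices, then Y < t needs two distinct terminals attached to one component, and a
union bound gives at most N u^2 t^2 c^2 ≤ u^(-4). It remains to rule out components of intermediate
size.

For this, colour each component red with probability s^|D| / (1 + (q-1)s^|D|), which is at most 1/q.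
Given the set R of red vertices, the graph on R is an ordinary binomial random graph
(`prod_compWeight_mul_bernSum`, `bernSum_mem_comps_mul`). A given component S is red with
probability at least s^|S|/q, and independently, by Markov, the other red components cover little
more than N/q vertices with probability bounded below (`ind_mem_comps_mul_le`). Since ρN ≤ λ < q,
the graph on such an R is subcritical with room to spare. Its expected number of components of size
n decays exponentially in n: it is compared with the random graph on d more vertices, where that
number is trivially at most N (`sum_compProb_powersetCard_le`, `sum_compProb_le_exp`). The critical
value λ_c enters only through λ_c < q. -/

/-! ### Sums over independent random subsets -/

/-- The expectation of `φ B`, where `B ⊆ E` contains each `e ∈ E` independently with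
probability `p e`. -/
noncomputable def bernSum {α : Type*} [DecidableEq α] (E : Finset α) (p : α → ℝ)
    (φ : Finset α → ℝ) : ℝ :=
  ∑ B ∈ E.powerset, (∏ e ∈ B, p e) * (∏ e ∈ E \ B, (1 - p e)) * φ B

open Classical in
/-- The indicator of a proposition. -/
noncomputable def ind (P : Prop) : ℝ := if P then 1 else 0

theorem ind_pos {P : Prop} (h : P) : ind P = 1 := if_pos h

theorem ind_neg {P : Prop} (h : ¬ P) : ind P = 0 := if_neg h

theorem ind_nonneg (P : Prop) : 0 ≤ ind P := by unfold ind; split_ifs <;> simp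

theorem ind_le_one (P : Prop) : ind P ≤ 1 := by unfold ind; split_ifs <;> simp

theorem ind_congr {P Q : Prop} (h : P ↔ Q) : ind P = ind Q := by rw [propext h]

theorem ind_and (P Q : Prop) : ind (P ∧ Q) = ind P * ind Q := by
  unfold ind; split_ifs <;> simp_all

theorem ind_mono {P Q : Prop} (h : P → Q) : ind P ≤ ind Q := by
  by_cases hp : P
  · rw [ind_pos hp, ind_pos (h hp)]
  · rw [ind_neg hp]; exact ind_nonneg Q

section bern

variable {α : Type*} [DecidableEq α] {E : Finset α} {p : α → ℝ}

@[simp] theorem bernSum_empty (φ : Finset α → ℝ) : bernSum ∅ p φ = φ ∅ := by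
  simp [bernSum]

theorem bernSum_congr {φ ψ : Finset α → ℝ} (h : ∀ B ⊆ E, φ B = ψ B) :
    bernSum E p φ = bernSum E p ψ :=
  Finset.sum_congr rfl fun B hB => by rw [h B (Finset.mem_powerset.1 hB)]

theorem bernSum_congr_prob {p' : α → ℝ} (h : ∀ e ∈ E, p e = p' e) (φ : Finset α → ℝ) :
    bernSum E p φ = bernSum E p' φ := by
  refine Finset.sum_congr rfl fun B hB => ?_
  have h1 : ∏ e ∈ B, p e = ∏ e ∈ B, p' e :=
    Finset.prod_congr rfl fun e he => h e (Finset.mem_powerset.1 hB he)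
  have h2 : ∏ e ∈ E \ B, (1 - p e) = ∏ e ∈ E \ B, (1 - p' e) :=
    Finset.prod_congr rfl fun e he => by rw [h e (Finset.mem_sdiff.1 he).1]
  rw [h1, h2]

theorem bernSum_insert {a : α} (ha : a ∉ E) (φ : Finset α → ℝ) :
    bernSum (insert a E) p φ =
      bernSum E p (fun B => (1 - p a) * φ B + p a * φ (insert a B)) := by
  unfold bernSum
  rw [Finset.sum_powerset_insert ha, ← Finset.sum_add_distrib]
  refine Finset.sum_congr rfl fun B hB => ?_
  have hB' := Finset.mem_powerset.1 hB
  have haB : a ∉ B := fun h => ha (hB' h)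
  have h1 : insert a E \ B = insert a (E \ B) := Finset.insert_sdiff_of_notMem _ haB
  have h2 : insert a E \ insert a B = E \ B := by
    rw [Finset.insert_sdiff_insert, Finset.sdiff_insert_of_notMem ha]
  rw [h1, h2, Finset.prod_insert (by simp [ha]), Finset.prod_insert haB]
  ring

theorem bernSum_union {E' : Finset α} (h : Disjoint E E') (φ : Finset α → ℝ) :
    bernSum (E ∪ E') p φ = bernSum E p (fun B => bernSum E' p (fun B' => φ (B ∪ B'))) := by
  induction E using Finset.induction_on generalizing φ with
  | empty => simp
  | insert a E ha ih =>
    rw [Finset.disjoint_insert_left] at h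
    rw [Finset.insert_union, bernSum_insert (by simp [ha, h.1]), ih h.2, bernSum_insert ha]
    refine bernSum_congr fun B _ => ?_
    simp only [bernSum, Finset.mul_sum, ← Finset.sum_add_distrib, Finset.insert_union]
    refine Finset.sum_congr rfl fun B' _ => ?_
    ring

theorem bernSum_const_mul (c : ℝ) (φ : Finset α → ℝ) :
    bernSum E p (fun B => c * φ B) = c * bernSum E p φ := by
  simp only [bernSum, Finset.mul_sum]
  exact Finset.sum_congr rfl fun B _ => by ring

theorem bernSum_add (φ ψ : Finset α → ℝ) :
    bernSum E p (fun B => φ B + ψ B) = bernSum E p φ + bernSum E p ψ := by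
  simp only [bernSum, ← Finset.sum_add_distrib]
  exact Finset.sum_congr rfl fun B _ => by ring

theorem bernSum_sum {ι : Type*} (s : Finset ι) (φ : ι → Finset α → ℝ) :
    bernSum E p (fun B => ∑ i ∈ s, φ i B) = ∑ i ∈ s, bernSum E p (φ i) := by
  simp only [bernSum, Finset.mul_sum]
  exact Finset.sum_comm

theorem bernSum_const (c : ℝ) : bernSum E p (fun _ => c) = c := by
  induction E using Finset.induction_on with
  | empty => simp
  | insert a E ha ih =>
    rw [bernSum_insert ha]
    rw [show (fun _ : Finset α => (1 - p a) * c + p a * c) = fun _ => c by ext; ring, ih]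

theorem bernSum_mono (hp : ∀ e, p e ∈ Set.Icc (0 : ℝ) 1) {φ ψ : Finset α → ℝ}
    (h : ∀ B ⊆ E, φ B ≤ ψ B) : bernSum E p φ ≤ bernSum E p ψ :=
  Finset.sum_le_sum fun B hB => mul_le_mul_of_nonneg_left (h B (Finset.mem_powerset.1 hB))
    (mul_nonneg (Finset.prod_nonneg fun e _ => (hp e).1)
      (Finset.prod_nonneg fun e _ => sub_nonneg.2 (hp e).2))

theorem bernSum_nonneg (hp : ∀ e, p e ∈ Set.Icc (0 : ℝ) 1) {φ : Finset α → ℝ}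
    (h : ∀ B ⊆ E, 0 ≤ φ B) : 0 ≤ bernSum E p φ := by
  rw [← bernSum_const (E := E) (p := p) 0]
  exact bernSum_mono hp h

theorem bernSum_mul {E' : Finset α} (h : Disjoint E E') (φ ψ : Finset α → ℝ) :
    bernSum (E ∪ E') p (fun B => φ (B ∩ E) * ψ (B ∩ E')) = bernSum E p φ * bernSum E' p ψ := by
  rw [bernSum_union h, mul_comm, ← bernSum_const_mul]
  refine bernSum_congr fun B hB => ?_
  rw [mul_comm, ← bernSum_const_mul]
  refine bernSum_congr fun B' hB' => ?_
  have h1 : (B ∪ B') ∩ E = B := by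
    rw [Finset.union_inter_distrib_right, Finset.inter_eq_left.2 hB,
      Finset.disjoint_iff_inter_eq_empty.1 ((h.mono_right hB').symm), Finset.union_empty]
  have h2 : (B ∪ B') ∩ E' = B' := by
    rw [Finset.union_inter_distrib_right, Finset.inter_eq_left.2 hB',
      Finset.disjoint_iff_inter_eq_empty.1 (h.mono_left hB), Finset.empty_union]
  rw [h1, h2]

theorem bernSum_one (h : ∀ e ∈ E, p e = 1) (φ : Finset α → ℝ) : bernSum E p φ = φ E := by
  induction E using Finset.induction_on generalizing φ with
  | empty => simp
  | insert a E ha ih =>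
    rw [bernSum_insert ha, ih (fun e he => h e (Finset.mem_insert_of_mem he)),
      h a (Finset.mem_insert_self _ _)]
    ring

theorem bernSum_map {β : Type*} [DecidableEq β] (ι : α ↪ β) (p : β → ℝ) (φ : Finset β → ℝ) :
    bernSum (E.map ι) p φ = bernSum E (fun a => p (ι a)) (fun B => φ (B.map ι)) := by
  induction E using Finset.induction_on generalizing φ with
  | empty => simp
  | insert a E ha ih =>
    rw [Finset.map_insert, bernSum_insert (by simpa using ha), ih, bernSum_insert ha]
    exact bernSum_congr fun B _ => by rw [Finset.map_insert]

theorem bernSum_disjoint {X : Finset α} (hX : X ⊆ E) :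
    bernSum E p (fun B => ind (Disjoint B X)) = ∏ e ∈ X, (1 - p e) := by
  have key : ∀ X : Finset α, bernSum X p (fun B => ind (B = ∅)) = ∏ e ∈ X, (1 - p e) := by
    intro X
    induction X using Finset.induction_on with
    | empty => simp [ind]
    | insert a X ha ih =>
      rw [bernSum_insert ha, Finset.prod_insert ha, ← ih, ← bernSum_const_mul]
      refine bernSum_congr fun B _ => ?_
      rw [ind_neg (Finset.insert_ne_empty a B)]
      ring
  have h := bernSum_mul (p := p) (Finset.disjoint_sdiff (s := X) (t := E))
    (fun B => ind (B = ∅)) (fun _ => 1)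
  rw [Finset.union_sdiff_of_subset hX, key, bernSum_const, mul_one] at h
  rw [← h]
  exact bernSum_congr fun B _ => by
    rw [mul_one]; exact ind_congr Finset.disjoint_iff_inter_eq_empty

theorem bernSum_prod {ι : Type*} [DecidableEq ι] (s : Finset ι) (X : ι → Finset α)
    (hX : (s : Set ι).PairwiseDisjoint X) (φ : ι → Finset α → ℝ) :
    bernSum (s.biUnion X) p (fun B => ∏ i ∈ s, φ i (B ∩ X i)) =
      ∏ i ∈ s, bernSum (X i) p (φ i) := by
  induction s using Finset.induction_on with
  | empty => simp
  | insert a s ha ih =>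
    have hd : Disjoint (X a) (s.biUnion X) := by
      rw [Finset.disjoint_biUnion_right]
      intro i hi
      exact hX (by simp) (by simp [hi]) (fun h => ha (h ▸ hi))
    rw [Finset.prod_insert ha, ← ih (hX.subset (by simp)), Finset.biUnion_insert,
      ← bernSum_mul hd]
    refine bernSum_congr fun B _ => ?_
    rw [Finset.prod_insert ha]
    congr 1
    refine Finset.prod_congr rfl fun i hi => ?_
    rw [Finset.inter_assoc, Finset.inter_eq_right.2 (Finset.subset_biUnion_of_mem X hi)]

/-- A decreasing `φ` is negatively correlated with `a ∈ B`: splitting on `a`, the two sides differ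
by the mean of p(1-p)(φ(B) - φ(B ∪ {a})). -/
theorem bernSum_mem_le (hp : ∀ e, p e ∈ Set.Icc (0 : ℝ) 1) {a : α} (ha : a ∈ E)
    {φ : Finset α → ℝ} (h : ∀ B, a ∉ B → φ (insert a B) ≤ φ B) :
    bernSum E p (fun B => ind (a ∈ B) * φ B) ≤ p a * bernSum E p φ := by
  rw [← Finset.insert_erase ha, bernSum_insert (Finset.notMem_erase a E),
    bernSum_insert (Finset.notMem_erase a E), ← bernSum_const_mul]
  refine bernSum_mono hp fun B hB => ?_
  have haB : a ∉ B := fun h => Finset.notMem_erase a E (hB h)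
  rw [ind_neg haB, ind_pos (Finset.mem_insert_self a B)]
  have := mul_nonneg (hp a).1 (mul_nonneg (sub_nonneg.2 (hp a).2) (sub_nonneg.2 (h B haB)))
  nlinarith

/-- On the event, `φ` sees only the coordinates outside `X`, which are independent of it; restoring
the coordinates in `X` costs at most the factor `q`. -/
theorem bernSum_disjoint_le (hp : ∀ e, p e ∈ Set.Icc (0 : ℝ) 1) {X : Finset α} (hX : X ⊆ E)
    {φ : Finset α → ℝ} {q : ℝ} (h : ∀ B, φ (B \ X) ≤ q * φ B) :
    bernSum E p (fun B => ind (Disjoint B X) * φ B) ≤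
      q * (∏ e ∈ X, (1 - p e)) * bernSum E p φ := by
  have h0 : 0 ≤ ∏ e ∈ X, (1 - p e) := Finset.prod_nonneg fun e _ => sub_nonneg.2 (hp e).2
  have e1 : bernSum E p (fun B => ind (Disjoint B X) * φ B) =
      (∏ e ∈ X, (1 - p e)) * bernSum (E \ X) p φ := by
    have h := bernSum_mul (p := p) (Finset.disjoint_sdiff (s := X) (t := E))
      (fun B => ind (Disjoint B X)) φ
    rw [Finset.union_sdiff_of_subset hX, bernSum_disjoint subset_rfl] at h
    rw [← h]
    refine bernSum_congr fun B hB => ?_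
    by_cases hd : Disjoint B X
    · rw [ind_pos hd, ind_pos (hd.mono_left Finset.inter_subset_left),
        ← Finset.inter_sdiff_assoc, Finset.inter_eq_left.2 hB, Finset.sdiff_eq_self_of_disjoint hd]
    · rw [ind_neg hd, ind_neg, zero_mul, zero_mul]
      rw [Finset.disjoint_iff_inter_eq_empty] at hd ⊢
      rwa [Finset.inter_assoc, Finset.inter_self]
  have e2 : bernSum (E \ X) p φ ≤ q * bernSum E p φ := by
    have h2 := bernSum_mul (p := p) (Finset.disjoint_sdiff (s := X) (t := E))
      (fun _ => 1) φ
    rw [Finset.union_sdiff_of_subset hX, bernSum_const, one_mul] at h2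
    rw [← h2, ← bernSum_const_mul]
    refine bernSum_mono hp fun B hB => ?_
    rw [one_mul, ← Finset.inter_sdiff_assoc, Finset.inter_eq_left.2 hB]
    exact h B
  rw [e1, mul_comm q, mul_assoc]
  exact mul_le_mul_of_nonneg_left e2 h0

theorem bernSum_sum_weights (w : α → ℝ) :
    bernSum E p (fun B => ∑ e ∈ B, w e) = ∑ e ∈ E, p e * w e := by
  induction E using Finset.induction_on with
  | empty => simp
  | insert a E ha ih =>
    rw [bernSum_insert ha, Finset.sum_insert ha, ← ih,
      ← bernSum_const (E := E) (p := p) (p a * w a), ← bernSum_add]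
    refine bernSum_congr fun B hB => ?_
    rw [Finset.sum_insert fun h => ha (hB h)]
    ring

/-- Markov's inequality, from the pointwise bound 1 - W/r ≤ 1[W ≤ r]. -/
theorem le_bernSum_sum_weights_le (hp : ∀ e, p e ∈ Set.Icc (0 : ℝ) 1) {w : α → ℝ}
    (hw : ∀ e, 0 ≤ w e) {r : ℝ} (hr : 0 < r) :
    1 - (∑ e ∈ E, p e * w e) / r ≤ bernSum E p (fun B => ind (∑ e ∈ B, w e ≤ r)) := by
  have h1 : 1 - (∑ e ∈ E, p e * w e) / r =
      bernSum E p (fun B => 1 + (-r⁻¹) * ∑ e ∈ B, w e) := by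
    rw [bernSum_add, bernSum_const, bernSum_const_mul, bernSum_sum_weights]
    ring
  rw [h1]
  refine bernSum_mono hp fun B _ => ?_
  have h0 : 0 ≤ ∑ e ∈ B, w e := Finset.sum_nonneg fun e _ => hw e
  by_cases h : ∑ e ∈ B, w e ≤ r
  · rw [ind_pos h]
    have := mul_nonneg (inv_nonneg.2 hr.le) h0
    linarith
  · rw [ind_neg h]
    have h2 : 1 ≤ r⁻¹ * ∑ e ∈ B, w e := by
      rw [inv_mul_eq_div, one_le_div hr]; linarith
    linarith

end bern

/-! ### Components as sets of vertices -/

section comps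

set_option linter.unusedSectionVars false

variable {K : Type*}

/-- `x` and `y` are joined by a path of edges in `B`. -/
def Linked (B : Finset (Sym2 K)) : K → K → Prop :=
  Relation.ReflTransGen fun x y => s(x, y) ∈ B

theorem Linked.symm {B : Finset (Sym2 K)} {x y : K} (h : Linked B x y) : Linked B y x := by
  induction h with
  | refl => exact Relation.ReflTransGen.refl
  | tail _ h ih => exact Relation.ReflTransGen.head (by rwa [Sym2.eq_swap]) ih

theorem Linked.mono {B B' : Finset (Sym2 K)} (hB : B ⊆ B') {x y : K} (h : Linked B x y) :
    Linked B' x y :=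
  Relation.ReflTransGen.mono (fun _ _ h => hB h) _ _ h

/-- No edge of `B` joins `Q` to its complement. -/
def EdgeClosed (B : Finset (Sym2 K)) (Q : Finset K) : Prop :=
  ∀ x y, s(x, y) ∈ B → x ∈ Q → y ∈ Q

theorem EdgeClosed.linked {B : Finset (Sym2 K)} {Q : Finset K} (h : EdgeClosed B Q) {x y : K}
    (hxy : Linked B x y) (hx : x ∈ Q) : y ∈ Q := by
  induction hxy with
  | refl => exact hx
  | tail _ h' ih => exact h _ _ h' ih

variable [Fintype K] [DecidableEq K]

open Classical in
/-- The vertex set of the component of `x` in the graph with edge set `B`. -/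
noncomputable def compOf (B : Finset (Sym2 K)) (x : K) : Finset K := {y | Linked B x y}

/-- The vertex sets of the components of the graph with edge set `B`. -/
noncomputable def comps (B : Finset (Sym2 K)) : Finset (Finset K) :=
  Finset.univ.image (compOf B)

/-- The edges of the complete graph on `Q`. -/
def edgesIn (Q : Finset K) : Finset (Sym2 K) := {e ∈ Q.sym2 | ¬ e.IsDiag}

theorem mem_compOf {B : Finset (Sym2 K)} {x y : K} : y ∈ compOf B x ↔ Linked B x y := by
  simp [compOf]

theorem self_mem_compOf (B : Finset (Sym2 K)) (x : K) : x ∈ compOf B x :=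
  mem_compOf.2 Relation.ReflTransGen.refl

theorem compOf_mem_comps (B : Finset (Sym2 K)) (x : K) : compOf B x ∈ comps B :=
  Finset.mem_image_of_mem _ (Finset.mem_univ x)

theorem compOf_eq_of_linked {B : Finset (Sym2 K)} {x y : K} (h : Linked B x y) :
    compOf B x = compOf B y := by
  ext z
  rw [mem_compOf, mem_compOf]
  exact ⟨fun h' => h.symm.trans h', fun h' => h.trans h'⟩

theorem eq_compOf {B : Finset (Sym2 K)} {D : Finset K} (hD : D ∈ comps B) {x : K} (hx : x ∈ D) :
    D = compOf B x := by
  obtain ⟨y, -, rfl⟩ := Finset.mem_image.1 hD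
  exact compOf_eq_of_linked (mem_compOf.1 hx)

theorem comps_nonempty {B : Finset (Sym2 K)} {D : Finset K} (hD : D ∈ comps B) : D.Nonempty := by
  obtain ⟨y, -, rfl⟩ := Finset.mem_image.1 hD
  exact ⟨y, self_mem_compOf B y⟩

theorem comps_eq_of_mem {B : Finset (Sym2 K)} {D D' : Finset K} (hD : D ∈ comps B)
    (hD' : D' ∈ comps B) {x : K} (hx : x ∈ D) (hx' : x ∈ D') : D = D' :=
  (eq_compOf hD hx).trans (eq_compOf hD' hx').symm

theorem comps_pairwiseDisjoint (B : Finset (Sym2 K)) :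
    (comps B : Set (Finset K)).PairwiseDisjoint id := fun _ hD _ hD' hne =>
  Finset.disjoint_left.2 fun _ hx hx' => hne (comps_eq_of_mem hD hD' hx hx')

theorem comps_biUnion (B : Finset (Sym2 K)) : (comps B).biUnion id = Finset.univ :=
  Finset.eq_univ_iff_forall.2 fun x =>
    Finset.mem_biUnion.2 ⟨_, compOf_mem_comps B x, self_mem_compOf B x⟩

theorem sum_card_comps (B : Finset (Sym2 K)) : ∑ D ∈ comps B, D.card = Fintype.card K := by
  have h := Finset.card_biUnion (comps_pairwiseDisjoint B)
  rw [comps_biUnion, Finset.card_univ] at h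
  exact h.symm

theorem card_comps_le (B : Finset (Sym2 K)) : (comps B).card ≤ Fintype.card K :=
  Finset.card_image_le

theorem mk_mem_edgesIn {Q : Finset K} {x y : K} :
    s(x, y) ∈ edgesIn Q ↔ (x ∈ Q ∧ y ∈ Q) ∧ x ≠ y := by
  simp [edgesIn]

theorem edgesIn_mono {Q R : Finset K} (h : Q ⊆ R) : edgesIn Q ⊆ edgesIn R :=
  Finset.filter_subset_filter _ (Finset.sym2_mono h)

theorem EdgeClosed.compl {B : Finset (Sym2 K)} {Q : Finset K} (h : EdgeClosed B Q) :
    EdgeClosed B Qᶜ := fun x y hxy hx => by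
  rw [Finset.mem_compl] at hx ⊢
  exact fun hy => hx (h y x (by rwa [Sym2.eq_swap]) hy)

theorem edgeClosed_of_mem_comps {B : Finset (Sym2 K)} {D : Finset K} (hD : D ∈ comps B) :
    EdgeClosed B D := fun x y hxy hx => by
  rw [eq_compOf hD hx]
  exact mem_compOf.2 (Relation.ReflTransGen.single hxy)

/-- A path that starts in `Q` stays in `Q`; loops, which `edgesIn` excludes, can be dropped from it.
-/
theorem EdgeClosed.linked_inter {B : Finset (Sym2 K)} {Q : Finset K} (h : EdgeClosed B Q)
    {x y : K} (hx : x ∈ Q) : Linked (B ∩ edgesIn Q) x y ↔ Linked B x y := by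
  refine ⟨Linked.mono Finset.inter_subset_left, fun hxy => ?_⟩
  induction hxy with
  | refl => exact Relation.ReflTransGen.refl
  | @tail y z hxy hyz ih =>
    by_cases hne : y = z
    · exact hne ▸ ih
    have hy := h.linked hxy hx
    exact ih.tail (Finset.mem_inter.2 ⟨hyz, mk_mem_edgesIn.2 ⟨⟨hy, h _ _ hyz hy⟩, hne⟩⟩)

theorem EdgeClosed.mem_comps_inter {B : Finset (Sym2 K)} {Q D : Finset K} (h : EdgeClosed B Q)
    (hD : D ⊆ Q) : D ∈ comps (B ∩ edgesIn Q) ↔ D ∈ comps B := by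
  have key : ∀ x ∈ Q, compOf (B ∩ edgesIn Q) x = compOf B x := fun x hx => by
    ext y; rw [mem_compOf, mem_compOf, h.linked_inter hx]
  constructor <;> intro hD'
  · obtain ⟨x, hx⟩ := comps_nonempty hD'
    rw [eq_compOf hD' hx, key x (hD hx)]
    exact compOf_mem_comps B x
  · obtain ⟨x, hx⟩ := comps_nonempty hD'
    rw [eq_compOf hD' hx, ← key x (hD hx)]
    exact compOf_mem_comps _ x

/-- Closedness does not depend on the edges inside `Q`, hence is independent of them. The same holds
for the components outside `Q` in `filter_comps_compl`. -/
theorem edgeClosed_inter_iff {B : Finset (Sym2 K)} {Q : Finset K} :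
    EdgeClosed (B \ edgesIn Q) Q ↔ EdgeClosed B Q := by
  refine ⟨fun h x y hxy hx => ?_, fun h x y hxy hx => h x y (Finset.mem_sdiff.1 hxy).1 hx⟩
  by_contra hy
  exact hy (h x y (Finset.mem_sdiff.2 ⟨hxy, fun h' => hy (mk_mem_edgesIn.1 h').1.2⟩) hx)

theorem filter_comps_compl {B : Finset (Sym2 K)} {Q : Finset K} (h : EdgeClosed B Q) :
    {D ∈ comps (B \ edgesIn Q) | D ⊆ Qᶜ} = {D ∈ comps B | D ⊆ Qᶜ} := by
  have h' := (edgeClosed_inter_iff.2 h).compl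
  ext D
  simp only [Finset.mem_filter, and_congr_left_iff]
  intro hD
  rw [← h.compl.mem_comps_inter hD, ← h'.mem_comps_inter hD]
  suffices h : (B \ edgesIn Q) ∩ edgesIn Qᶜ = B ∩ edgesIn Qᶜ by rw [h]
  ext e
  induction e with
  | _ x y =>
    simp only [Finset.mem_inter, Finset.mem_sdiff, mk_mem_edgesIn, Finset.mem_compl]
    tauto

/-! ### Colouring the components -/

/-- The weight of a component of size `n`. -/
noncomputable def compWeight (q s : ℝ) (n : ℕ) : ℝ := 1 + (q - 1) * s ^ n

/-- The part of the weight of the components inside `Q` that is not red. -/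
noncomputable def greenWeight (q s : ℝ) (Q : Finset K) (B : Finset (Sym2 K)) : ℝ :=
  ∏ D ∈ comps B with D ⊆ Q, (compWeight q s D.card - s ^ D.card)

theorem compWeight_pos {q s : ℝ} (hq : 1 ≤ q) (hs : 0 ≤ s) (n : ℕ) : 0 < compWeight q s n := by
  have := mul_nonneg (sub_nonneg.2 hq) (pow_nonneg hs n)
  unfold compWeight; linarith

/-- This bounds the probability of red by 1/q, whatever the component size. It is the source of the
threshold q for λ. -/
theorem pow_le_compWeight_div {q s : ℝ} (hq : 1 ≤ q) (hs : s ∈ Set.Icc (0 : ℝ) 1) (n : ℕ) :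
    s ^ n ≤ compWeight q s n / q := by
  rw [le_div_iff₀ (by linarith)]
  have := pow_le_one₀ hs.1 hs.2 (n := n)
  unfold compWeight; linarith

theorem compWeight_le {q s : ℝ} (hq : 1 ≤ q) (hs : s ∈ Set.Icc (0 : ℝ) 1) (n : ℕ) :
    compWeight q s n ≤ q := by
  have := mul_le_mul_of_nonneg_left (pow_le_one₀ hs.1 hs.2 (n := n)) (sub_nonneg.2 hq)
  unfold compWeight; linarith

theorem red_prob_mem {q s : ℝ} (hq : 1 ≤ q) (hs : s ∈ Set.Icc (0 : ℝ) 1) (n : ℕ) :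
    s ^ n / compWeight q s n ∈ Set.Icc (0 : ℝ) 1 := by
  have h := compWeight_pos hq hs.1 n
  refine ⟨div_nonneg (pow_nonneg hs.1 n) h.le, ?_⟩
  rw [div_le_one h]
  exact (pow_le_compWeight_div hq hs n).trans (div_le_self h.le hq)

theorem greenWeight_nonneg {q s : ℝ} (hq : 1 ≤ q) (hs : s ∈ Set.Icc (0 : ℝ) 1) (Q : Finset K)
    (B : Finset (Sym2 K)) : 0 ≤ greenWeight q s Q B :=
  Finset.prod_nonneg fun _ _ => sub_nonneg.2 <| (pow_le_compWeight_div hq hs _).trans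
    (div_le_self (compWeight_pos hq hs.1 _).le hq)

theorem EdgeClosed.biUnion_filter {B : Finset (Sym2 K)} {R : Finset K} (hR : EdgeClosed B R) :
    {D ∈ comps B | D ⊆ R}.biUnion id = R := by
  ext x
  rw [Finset.mem_biUnion]
  refine ⟨fun ⟨D, hD, hx⟩ => (Finset.mem_filter.1 hD).2 hx, fun hx =>
    ⟨compOf B x, Finset.mem_filter.2 ⟨compOf_mem_comps B x, fun y hy => ?_⟩,
      self_mem_compOf B x⟩⟩
  exact hR.linked (mem_compOf.1 hy) hx

-- Expand the product over components according to the set of red ones. Sets of components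
-- correspond to edge-closed vertex sets `R` through their union, the red factors multiply to s^|R|,
-- and the others form `greenWeight`.
open Classical in
theorem prod_compWeight_mul_bernSum {q s : ℝ} (hq : 1 ≤ q) (hs : 0 ≤ s)
    (B : Finset (Sym2 K)) (φ : Finset (Finset K) → ℝ) :
    (∏ D ∈ comps B, compWeight q s D.card) *
        bernSum (comps B) (fun D => s ^ D.card / compWeight q s D.card) φ =
      ∑ R : Finset K, ind (EdgeClosed B R) *
        (s ^ R.card * greenWeight q s Rᶜ B * φ {D ∈ comps B | D ⊆ R}) := by
  have hf : ∀ n, compWeight q s n ≠ 0 := fun n => (compWeight_pos hq hs n).ne'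
  rw [bernSum, Finset.mul_sum]
  have e : ∀ R : Finset K, ind (EdgeClosed B R) *
        (s ^ R.card * greenWeight q s Rᶜ B * φ {D ∈ comps B | D ⊆ R}) =
      if EdgeClosed B R then
        s ^ R.card * greenWeight q s Rᶜ B * φ {D ∈ comps B | D ⊆ R} else 0 := fun R => by
    unfold ind; split_ifs <;> simp
  rw [Finset.sum_congr rfl fun R _ => e R, ← Finset.sum_filter]
  -- A component meeting the union of `J` belongs to `J`, as components are nonempty and disjoint.
  have back : ∀ J ⊆ comps B, {D ∈ comps B | D ⊆ J.biUnion id} = J := fun J hJ => by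
    ext D
    rw [Finset.mem_filter]
    refine ⟨fun ⟨hD, hDJ⟩ => ?_, fun hD => ⟨hJ hD, Finset.subset_biUnion_of_mem id hD⟩⟩
    obtain ⟨x, hx⟩ := comps_nonempty hD
    obtain ⟨D', hD', hx'⟩ := Finset.mem_biUnion.1 (hDJ hx)
    rwa [comps_eq_of_mem hD (hJ hD') hx hx']
  refine Finset.sum_nbij' (fun J => J.biUnion id) (fun R => {D ∈ comps B | D ⊆ R})
    (fun J hJ => ?_) (fun R hR => ?_) (fun J hJ => ?_) (fun R hR => ?_) (fun J hJ => ?_)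
  · rw [Finset.mem_powerset] at hJ
    refine Finset.mem_filter.2 ⟨Finset.mem_univ _, fun x y hxy hx => ?_⟩
    obtain ⟨D, hD, hxD⟩ := Finset.mem_biUnion.1 hx
    exact Finset.mem_biUnion.2 ⟨D, hD, edgeClosed_of_mem_comps (hJ hD) x y hxy hxD⟩
  · exact Finset.mem_powerset.2 (Finset.filter_subset _ _)
  · exact back J (Finset.mem_powerset.1 hJ)
  · exact (Finset.mem_filter.1 hR).2.biUnion_filter
  · rw [Finset.mem_powerset] at hJ
    have h1 : s ^ (J.biUnion id).card = ∏ D ∈ J, s ^ D.card := by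
      rw [Finset.card_biUnion ((comps_pairwiseDisjoint B).subset hJ), Finset.prod_pow_eq_pow_sum]
      rfl
    have h2 : {D ∈ comps B | D ⊆ (J.biUnion id)ᶜ} = comps B \ J := by
      ext D
      rw [Finset.mem_filter, Finset.mem_sdiff]
      refine and_congr_right fun hD => ⟨fun h hDJ => ?_, fun hDJ x hx => ?_⟩
      · obtain ⟨x, hx⟩ := comps_nonempty hD
        exact Finset.mem_compl.1 (h hx) (Finset.mem_biUnion.2 ⟨D, hDJ, hx⟩)
      · rw [Finset.mem_compl]
        intro hx'
        obtain ⟨D', hD', hx'⟩ := Finset.mem_biUnion.1 hx'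
        exact hDJ (comps_eq_of_mem hD (hJ hD') hx hx' ▸ hD')
    rw [back J hJ, h1, greenWeight, h2, ← Finset.prod_sdiff hJ, ← mul_assoc]
    congr 1
    have a : (∏ D ∈ J, compWeight q s D.card) * ∏ D ∈ J, s ^ D.card / compWeight q s D.card =
        ∏ D ∈ J, s ^ D.card := by
      rw [← Finset.prod_mul_distrib]
      exact Finset.prod_congr rfl fun D _ => mul_div_cancel₀ _ (hf _)
    have b : (∏ D ∈ comps B \ J, compWeight q s D.card) *
        ∏ D ∈ comps B \ J, (1 - s ^ D.card / compWeight q s D.card) =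
        ∏ D ∈ comps B \ J, (compWeight q s D.card - s ^ D.card) := by
      rw [← Finset.prod_mul_distrib]
      exact Finset.prod_congr rfl fun D _ => by
        rw [mul_sub, mul_one, mul_div_cancel₀ _ (hf _)]
    rw [← a, ← b]
    ring

end comps

/-! ### Components of given size in the binomial random graph -/

section random_graph

set_option linter.unusedSectionVars false

variable {K : Type*} [Fintype K] [DecidableEq K]

/-- The probability that `S` is a component of the binomial random graph on `R`. -/
noncomputable def compProb (ρ : ℝ) (R S : Finset K) : ℝ :=
  bernSum (edgesIn R) (fun _ => ρ) (fun B => ind (S ∈ comps B))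

theorem compProb_nonneg {ρ : ℝ} (hρ : ρ ∈ Set.Icc (0 : ℝ) 1) (R S : Finset K) :
    0 ≤ compProb ρ R S :=
  bernSum_nonneg (fun _ => hρ) fun _ _ => ind_nonneg _

/-- Being a component means being connected through edges inside `S` and having no edge to `R \ S`;
these events are independent. -/
theorem compProb_eq (ρ : ℝ) {R S : Finset K} (hS : S ⊆ R) :
    compProb ρ R S = compProb ρ S S * (1 - ρ) ^ (S.card * (R.card - S.card)) := by
  set X : Finset (Sym2 K) := (S ×ˢ (R \ S)).image (fun x => s(x.1, x.2)) with hXdef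
  have memX : ∀ x y, x ∈ S → y ∈ R → y ∉ S → s(x, y) ∈ X := fun x y hx hy hy' =>
    Finset.mem_image.2 ⟨(x, y), by simp [hx, hy, hy'], rfl⟩
  have ofX : ∀ e ∈ X, ∃ x y, x ∈ S ∧ y ∈ R ∧ y ∉ S ∧ e = s(x, y) := fun e he => by
    obtain ⟨⟨x, y⟩, h, rfl⟩ := Finset.mem_image.1 he
    simp only [Finset.mem_product, Finset.mem_sdiff] at h
    exact ⟨x, y, h.1, h.2.1, h.2.2, rfl⟩
  have hX : X ⊆ edgesIn R \ edgesIn S := fun e he => by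
    obtain ⟨x, y, hx, hy, hy', rfl⟩ := ofX e he
    rw [Finset.mem_sdiff, mk_mem_edgesIn, mk_mem_edgesIn]
    exact ⟨⟨⟨hS hx, hy⟩, fun h => hy' (h ▸ hx)⟩, fun h => hy' h.1.2⟩
  have hcard : X.card = S.card * (R.card - S.card) := by
    rw [hXdef, Finset.card_image_of_injOn, Finset.card_product, Finset.card_sdiff_of_subset hS]
    rintro ⟨x, y⟩ h ⟨x', y'⟩ h' heq
    simp only [Finset.coe_product, Set.mem_prod, Finset.mem_coe, Finset.mem_sdiff] at h h'
    rcases Sym2.eq_iff.1 heq with h'' | h''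
    · exact Prod.ext h''.1 h''.2
    · exact absurd ((show x = y' from h''.1) ▸ h.1) h'.2.2
  have key := bernSum_mul (p := fun _ => ρ)
    (Finset.disjoint_sdiff (s := edgesIn S) (t := edgesIn R))
    (fun B => ind (S ∈ comps B)) (fun B => ind (Disjoint B X))
  rw [Finset.union_sdiff_of_subset (edgesIn_mono hS), bernSum_disjoint hX, Finset.prod_const,
    hcard] at key
  rw [compProb, compProb, ← key]
  refine bernSum_congr fun B hB => ?_
  rw [← ind_and]
  refine ind_congr ⟨fun h => ?_, fun ⟨h1, h2⟩ => ?_⟩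
  · have hc := edgeClosed_of_mem_comps h
    refine ⟨(hc.mem_comps_inter subset_rfl).2 h, Finset.disjoint_left.2 fun e he heX => ?_⟩
    obtain ⟨x, y, hx, hy, hy', rfl⟩ := ofX e heX
    exact hy' (hc x y (Finset.mem_inter.1 he).1 hx)
  · have hc : EdgeClosed B S := fun x y hxy hx => by
      by_contra hy
      have hyR := (mk_mem_edgesIn.1 (hB hxy)).1.2
      have := memX x y hx hyR hy
      exact Finset.disjoint_left.1 h2 (Finset.mem_inter.2 ⟨hxy, hX this⟩) this
    exact (hc.mem_comps_inter subset_rfl).1 h1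

theorem mk_mem_map_sym2Map {B : Finset (Sym2 K)} {σ : Equiv.Perm K} {x y : K} :
    s(σ x, σ y) ∈ B.map σ.toEmbedding.sym2Map ↔ s(x, y) ∈ B :=
  Finset.mem_map' σ.toEmbedding.sym2Map (a := s(x, y))

theorem Linked.map_equiv {B : Finset (Sym2 K)} (σ : Equiv.Perm K) {x y : K} :
    Linked (B.map σ.toEmbedding.sym2Map) (σ x) (σ y) ↔ Linked B x y := by
  constructor
  · suffices h : ∀ v, Linked (B.map σ.toEmbedding.sym2Map) (σ x) v → Linked B x (σ.symm v) from
      fun h' => by simpa using h _ h'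
    intro v h
    induction h with
    | refl => rw [σ.symm_apply_apply]; exact Relation.ReflTransGen.refl
    | @tail u v _ huv ih =>
      refine ih.tail (mk_mem_map_sym2Map (σ := σ).1 ?_)
      simpa using huv
  · intro h
    induction h with
    | refl => exact Relation.ReflTransGen.refl
    | tail _ huv ih => exact ih.tail (mk_mem_map_sym2Map.2 huv)

/-- By symmetry: a bijection from `S` to `S'` extends to a permutation of `K`. -/
theorem compProb_self_congr (ρ : ℝ) {S S' : Finset K} (h : S.card = S'.card) :
    compProb ρ S S = compProb ρ S' S' := by
  obtain ⟨σ, rfl⟩ : ∃ σ : Equiv.Perm K, S' = S.map σ.toEmbedding := by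
    refine ⟨(Finset.equivOfCardEq h).extendSubtype, ?_⟩
    symm
    refine Finset.eq_of_subset_of_card_le (fun x hx => ?_) (by simp [h])
    obtain ⟨y, hy, rfl⟩ := Finset.mem_map.1 hx
    exact (Finset.equivOfCardEq h).extendSubtype_mem y hy
  have hE : edgesIn (S.map σ.toEmbedding) =
      (edgesIn S).map σ.toEmbedding.sym2Map := by
    ext e
    induction e with
    | _ x y =>
      obtain ⟨x, rfl⟩ := σ.surjective x
      obtain ⟨y, rfl⟩ := σ.surjective y
      rw [mk_mem_map_sym2Map, mk_mem_edgesIn, mk_mem_edgesIn]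
      simp
  have hcomp : ∀ B x, compOf (B.map σ.toEmbedding.sym2Map) (σ x) =
      (compOf B x).map σ.toEmbedding := fun B x => by
    ext y
    obtain ⟨y, rfl⟩ := σ.surjective y
    rw [mem_compOf, Linked.map_equiv, ← mem_compOf]
    simp
  rw [compProb, compProb, hE, bernSum_map]
  refine bernSum_congr fun B _ => ind_congr ?_
  simp only [comps, Finset.mem_image, Finset.mem_univ, true_and]
  constructor
  · rintro ⟨x, rfl⟩
    exact ⟨σ x, hcomp B x⟩
  · rintro ⟨x, hx⟩
    obtain ⟨x, rfl⟩ := σ.surjective x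
    rw [hcomp] at hx
    exact ⟨x, Finset.map_injective _ hx⟩

theorem sum_compProb_le {ρ : ℝ} (hρ : ρ ∈ Set.Icc (0 : ℝ) 1) (R : Finset K)
    (𝒮 : Finset (Finset K)) : ∑ S ∈ 𝒮, compProb ρ R S ≤ Fintype.card K := by
  unfold compProb
  rw [← bernSum_sum, ← bernSum_const (E := edgesIn R) (p := fun _ => ρ) (Fintype.card K : ℝ)]
  refine bernSum_mono (fun _ => hρ) fun B _ => ?_
  have h : ∑ S ∈ 𝒮, ind (S ∈ comps B) = ((𝒮.filter (· ∈ comps B)).card : ℝ) := by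
    rw [Finset.card_filter, Nat.cast_sum]
    refine Finset.sum_congr rfl fun S _ => ?_
    unfold ind; split_ifs <;> simp
  rw [h, Nat.cast_le]
  exact (Finset.card_le_card fun S hS => (Finset.mem_filter.1 hS).2).trans (card_comps_le B)

/-- The ratio of the binomial coefficients is ∏ (r-i)/(r+d-i) over i < k, and each factor is at most
r/(r+d). -/
theorem choose_mul_pow_le (r d k : ℕ) :
    (r.choose k : ℝ) * ((r : ℝ) + d) ^ k ≤ ((r + d).choose k : ℝ) * (r : ℝ) ^ k := by
  induction k with
  | zero => simp
  | succ k ih =>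
    rcases le_or_gt r k with hk | hk
    · rw [Nat.choose_eq_zero_of_lt (by omega), Nat.cast_zero, zero_mul]
      positivity
    have h1 : (r.choose (k + 1) : ℝ) * (k + 1) = r.choose k * (r - k) := by
      have := Nat.choose_succ_right_eq r k
      have h := congrArg (Nat.cast : ℕ → ℝ) this
      push_cast [Nat.cast_sub hk.le] at h
      exact h
    have h2 : ((r + d).choose (k + 1) : ℝ) * (k + 1) = (r + d).choose k * (r + d - k) := by
      have := Nat.choose_succ_right_eq (r + d) k
      have h := congrArg (Nat.cast : ℕ → ℝ) this
      push_cast [Nat.cast_sub (show k ≤ r + d by omega)] at h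
      exact h
    have hk0 : (0 : ℝ) < k + 1 := by positivity
    have hrk : (0 : ℝ) ≤ r - k := sub_nonneg.2 (by exact_mod_cast hk.le)
    refine le_of_mul_le_mul_right ?_ hk0
    calc (r.choose (k + 1) : ℝ) * ((r : ℝ) + d) ^ (k + 1) * (k + 1)
        = (r.choose k * ((r : ℝ) + d) ^ k) * ((r - k) * (r + d)) := by
          rw [mul_right_comm, h1]; ring
      _ ≤ ((r + d).choose k * (r : ℝ) ^ k) * ((r + d - k) * r) := by
          refine mul_le_mul ih ?_ (by positivity) (by positivity)
          have : (0 : ℝ) ≤ d * k := by positivity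
          nlinarith
      _ = ((r + d).choose (k + 1) : ℝ) * (r : ℝ) ^ (k + 1) * (k + 1) := by
          rw [mul_right_comm ((r + d).choose (k + 1) : ℝ), h2]; ring

/-- Comparison with the random graph on `d` more vertices, where the expected number of
components of size `k` is at most `card K`. -/
theorem sum_compProb_powersetCard_le {ρ : ℝ} (hρ : ρ ∈ Set.Icc (0 : ℝ) 1) (R : Finset K)
    (k d : ℕ) (hd : R.card + d ≤ Fintype.card K) :
    (∑ S ∈ R.powersetCard k, compProb ρ R S) * (((R.card : ℝ) + d) ^ k * (1 - ρ) ^ (k * d)) ≤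
      Fintype.card K * (R.card : ℝ) ^ k := by
  have h1ρ : 0 ≤ 1 - ρ := sub_nonneg.2 hρ.2
  rcases lt_or_ge R.card k with hk | hk
  · rw [Finset.powersetCard_eq_empty.2 hk, Finset.sum_empty, zero_mul]
    positivity
  obtain ⟨S₀, hS₀R, hS₀⟩ := Finset.exists_subset_card_eq hk
  obtain ⟨R', hRR', hR'⟩ := Finset.exists_superset_card_eq (n := R.card + d)
    (Nat.le_add_right _ _) hd
  -- All `k`-subsets contribute equally, and `Q` matters only through its size. So the sums for `R`
  -- and `R'` differ by an explicit factor and the unknown connectivity probability cancels.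
  have key : ∀ Q : Finset K, ∑ S ∈ Q.powersetCard k, compProb ρ Q S =
      Q.card.choose k * (compProb ρ S₀ S₀ * (1 - ρ) ^ (k * (Q.card - k))) := fun Q => by
    rw [Finset.sum_congr rfl (g := fun _ => compProb ρ S₀ S₀ * (1 - ρ) ^ (k * (Q.card - k))),
      Finset.sum_const, Finset.card_powersetCard, nsmul_eq_mul]
    intro S hS
    rw [Finset.mem_powersetCard] at hS
    rw [compProb_eq ρ hS.1, hS.2, compProb_self_congr ρ (hS.2.trans hS₀.symm)]
  have hR'' := sum_compProb_le hρ R' (R'.powersetCard k)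
  rw [key, hR'] at hR''
  rw [key]
  have hexp : k * (R.card + d - k) = k * (R.card - k) + k * d := by
    rw [← mul_add]; congr 1; omega
  rw [hexp, pow_add] at hR''
  have hc := compProb_nonneg hρ S₀ S₀
  calc _ = ((R.card.choose k : ℝ) * ((R.card : ℝ) + d) ^ k) *
        (compProb ρ S₀ S₀ * ((1 - ρ) ^ (k * (R.card - k)) * (1 - ρ) ^ (k * d))) := by ring
    _ ≤ (((R.card + d).choose k : ℝ) * (R.card : ℝ) ^ k) *
        (compProb ρ S₀ S₀ * ((1 - ρ) ^ (k * (R.card - k)) * (1 - ρ) ^ (k * d))) :=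
      mul_le_mul_of_nonneg_right (choose_mul_pow_le _ _ _) (by positivity)
    _ = (((R.card + d).choose k : ℝ) *
        (compProb ρ S₀ S₀ * ((1 - ρ) ^ (k * (R.card - k)) * (1 - ρ) ^ (k * d)))) *
          (R.card : ℝ) ^ k := by ring
    _ ≤ _ := mul_le_mul_of_nonneg_right hR'' (by positivity)

/-! ### Components of given size in the weighted graph -/

/-- The partition function of the graphs on `K` in which a component of size `n` has weight
`compWeight q s n`. -/
noncomputable def compPartition (K : Type*) [Fintype K] [DecidableEq K] (q s ρ : ℝ) : ℝ :=
  bernSum (edgesIn (Finset.univ : Finset K)) (fun _ => ρ)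
    (fun B => ∏ D ∈ comps B, compWeight q s D.card)

/-- Given that `R` is the red set, the graph on `R` is binomial: closedness and the green weight
depend only on edges not inside `R`, while on that event `S ∈ comps B` depends only on edges inside
`R`. -/
theorem bernSum_mem_comps_mul (q s ρ : ℝ) {R S : Finset K} (hS : S ⊆ R) :
    bernSum (edgesIn Finset.univ) (fun _ => ρ)
        (fun B => ind (S ∈ comps B) * (ind (EdgeClosed B R) * greenWeight q s Rᶜ B)) =
      compProb ρ R S * bernSum (edgesIn Finset.univ) (fun _ => ρ)
        (fun B => ind (EdgeClosed B R) * greenWeight q s Rᶜ B) := by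
  have hd := Finset.disjoint_sdiff (s := edgesIn R) (t := edgesIn (Finset.univ : Finset K))
  have hψ : ∀ B ⊆ edgesIn (Finset.univ : Finset K),
      ind (EdgeClosed (B ∩ (edgesIn Finset.univ \ edgesIn R)) R) *
        greenWeight q s Rᶜ (B ∩ (edgesIn Finset.univ \ edgesIn R)) =
      ind (EdgeClosed B R) * greenWeight q s Rᶜ B := fun B hB => by
    have : B ∩ (edgesIn Finset.univ \ edgesIn R) = B \ edgesIn R := by
      rw [← Finset.inter_sdiff_assoc, Finset.inter_eq_left.2 hB]
    rw [this, ind_congr edgeClosed_inter_iff]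
    by_cases hc : EdgeClosed B R
    · rw [greenWeight, filter_comps_compl hc, greenWeight]
    · rw [ind_neg hc, zero_mul, zero_mul]
  have h1 := bernSum_mul (p := fun _ => ρ) hd (fun B => ind (S ∈ comps B))
    (fun B => ind (EdgeClosed B R) * greenWeight q s Rᶜ B)
  have h2 := bernSum_mul (p := fun _ => ρ) hd (fun _ => 1)
    (fun B => ind (EdgeClosed B R) * greenWeight q s Rᶜ B)
  rw [Finset.union_sdiff_of_subset (edgesIn_mono (Finset.subset_univ R))] at h1 h2
  rw [bernSum_const, one_mul] at h2
  have h3 := bernSum_congr (p := fun _ => ρ) (ψ := fun B =>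
    ind (EdgeClosed B R) * greenWeight q s Rᶜ B) fun B hB => (one_mul _).trans (hψ B hB)
  rw [← h2, h3] at h1
  rw [compProb, ← h1]
  refine bernSum_congr fun B hB => ?_
  rw [hψ B hB]
  by_cases hc : EdgeClosed B R
  · rw [ind_congr (hc.mem_comps_inter hS)]
  · rw [ind_neg hc, zero_mul, mul_zero, mul_zero]

/-- With probability at least s^|S|/(qM), `S` is red and the other red components cover at most `m`
vertices. Dividing by this probability bounds the weight of `B` by the coloured sum over small `R`
containing `S`. -/
theorem ind_mem_comps_mul_le {q s m M : ℝ} (hq : 1 ≤ q) (hs : 0 < s) (hs1 : s ≤ 1) (hm : 0 < m)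
    (hM : 0 < M) (hMm : 1 ≤ M * (1 - Fintype.card K / q / m)) (B : Finset (Sym2 K))
    (S : Finset K) :
    ind (S ∈ comps B) * ∏ D ∈ comps B, compWeight q s D.card ≤
      q * (s ^ S.card)⁻¹ * M * ∑ R : Finset K, ind (S ⊆ R ∧ (R.card : ℝ) ≤ m + S.card) *
        (s ^ R.card * (ind (S ∈ comps B) * (ind (EdgeClosed B R) * greenWeight q s Rᶜ B))) := by
  by_cases hS : S ∈ comps B
  swap
  · simp [ind_neg hS]
  simp only [ind_pos hS, one_mul]
  have hs' : s ∈ Set.Icc (0 : ℝ) 1 := ⟨hs.le, hs1⟩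
  set p : Finset K → ℝ := fun D => s ^ D.card / compWeight q s D.card with hpdef
  have hp : ∀ D, p D ∈ Set.Icc (0 : ℝ) 1 := fun D => red_prob_mem hq hs' _
  have hF : 0 ≤ ∏ D ∈ comps B, compWeight q s D.card :=
    Finset.prod_nonneg fun D _ => (compWeight_pos hq hs.le _).le
  set φ : Finset (Finset K) → ℝ :=
    fun J => ind (S ∈ J ∧ ((J.biUnion id).card : ℝ) ≤ m + S.card) with hφ
  have hq0 : 0 < q := by linarith
  have hlow : s ^ S.card / q * (1 - Fintype.card K / q / m) ≤ bernSum (comps B) p φ := by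
    have hnm : S ∉ (comps B).erase S := Finset.notMem_erase _ _
    have h1 : 0 ≤ 1 - Fintype.card K / q / m := by
      by_contra h
      have := mul_nonpos_of_nonneg_of_nonpos hM.le (not_le.1 h).le
      linarith
    have h2 : s ^ S.card / q ≤ p S :=
      div_le_div_of_nonneg_left (pow_nonneg hs.le _) (compWeight_pos hq hs.le _)
        (compWeight_le hq hs' _)
    have h3 := le_bernSum_sum_weights_le (E := (comps B).erase S) hp
      (w := fun D => (D.card : ℝ)) (fun _ => Nat.cast_nonneg _) hm
    -- Each component is red with probability at most 1/q and the sizes sum to |K|.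
    have h4 : ∑ D ∈ (comps B).erase S, p D * (D.card : ℝ) ≤ Fintype.card K / q := by
      calc ∑ D ∈ (comps B).erase S, p D * (D.card : ℝ)
          ≤ ∑ D ∈ comps B, p D * (D.card : ℝ) :=
            Finset.sum_le_sum_of_subset_of_nonneg (Finset.erase_subset _ _)
              fun D _ _ => mul_nonneg (hp D).1 (Nat.cast_nonneg _)
        _ ≤ ∑ D ∈ comps B, q⁻¹ * (D.card : ℝ) := by
            refine Finset.sum_le_sum fun D _ =>
              mul_le_mul_of_nonneg_right ?_ (Nat.cast_nonneg _)
            rw [hpdef, div_le_iff₀ (compWeight_pos hq hs.le _), inv_mul_eq_div]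
            exact pow_le_compWeight_div hq hs' _
        _ = Fintype.card K / q := by
            rw [← Finset.mul_sum, ← Nat.cast_sum, sum_card_comps, inv_mul_eq_div]
    rw [← Finset.insert_erase hS, bernSum_insert hnm]
    calc s ^ S.card / q * (1 - Fintype.card K / q / m)
        ≤ p S * bernSum ((comps B).erase S) p (fun J => ind (∑ D ∈ J, (D.card : ℝ) ≤ m)) := by
          refine mul_le_mul h2 (le_trans ?_ h3) h1 (hp S).1
          have := div_le_div_of_nonneg_right h4 hm.le
          linarith
      _ ≤ _ := by
          rw [← bernSum_const_mul]
          refine bernSum_mono hp fun J hJ => ?_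
          have : ind (∑ D ∈ J, (D.card : ℝ) ≤ m) ≤ φ (insert S J) := by
            refine ind_mono fun hJm => ⟨Finset.mem_insert_self _ _, ?_⟩
            have h5 : ((insert S J).biUnion id).card ≤ S.card + ∑ D ∈ J, D.card := by
              rw [Finset.biUnion_insert]
              exact (Finset.card_union_le _ _).trans
                (Nat.add_le_add_left Finset.card_biUnion_le _)
            have h6 : (((insert S J).biUnion id).card : ℝ) ≤ S.card + ∑ D ∈ J, (D.card : ℝ) := by
              exact_mod_cast h5
            linarith
          have h7 := mul_le_mul_of_nonneg_left this (hp S).1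
          have h8 : 0 ≤ (1 - p S) * φ J :=
            mul_nonneg (sub_nonneg.2 (hp S).2) (ind_nonneg _)
          linarith
  have hcol := prod_compWeight_mul_bernSum hq hs.le B φ
  have hsp : 0 < s ^ S.card := pow_pos hs _
  calc ∏ D ∈ comps B, compWeight q s D.card
      ≤ (q * (s ^ S.card)⁻¹ * M) * ((∏ D ∈ comps B, compWeight q s D.card) *
          (s ^ S.card / q * (1 - Fintype.card K / q / m))) := by
        have : (q * (s ^ S.card)⁻¹ * M) * ((∏ D ∈ comps B, compWeight q s D.card) *
          (s ^ S.card / q * (1 - Fintype.card K / q / m))) =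
          (∏ D ∈ comps B, compWeight q s D.card) * (M * (1 - Fintype.card K / q / m)) := by
            field_simp
        rw [this]
        exact le_mul_of_one_le_right hF hMm
    _ ≤ (q * (s ^ S.card)⁻¹ * M) * ((∏ D ∈ comps B, compWeight q s D.card) *
          bernSum (comps B) p φ) := by gcongr
    _ = _ := by
        rw [hcol]
        congr 1
        refine Finset.sum_congr rfl fun R _ => ?_
        by_cases hc : EdgeClosed B R
        · simp only [hφ, hc.biUnion_filter, Finset.mem_filter, hS, true_and]
          ring
        · simp [ind_neg hc]

/-- The expected number of components of size `k` in the weighted graph, in terms of the expected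
number of components of size `k` in the binomial random graphs on fewer vertices. -/
theorem sum_bernSum_mem_comps_le {q s ρ m M b : ℝ} {k : ℕ} (hq : 1 ≤ q) (hs : 0 < s)
    (hs1 : s ≤ 1) (hρ : ρ ∈ Set.Icc (0 : ℝ) 1) (hm : 0 < m) (hM : 0 < M)
    (hMm : 1 ≤ M * (1 - Fintype.card K / q / m)) (hb0 : 0 ≤ b)
    (hb : ∀ R : Finset K, (R.card : ℝ) ≤ m + k → ∑ S ∈ R.powersetCard k, compProb ρ R S ≤ b) :
    ∑ S ∈ (Finset.univ : Finset K).powersetCard k,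
        bernSum (edgesIn Finset.univ) (fun _ => ρ)
          (fun B => ind (S ∈ comps B) * ∏ D ∈ comps B, compWeight q s D.card) ≤
      q * (s ^ k)⁻¹ * M * b * compPartition K q s ρ := by
  have hs' : s ∈ Set.Icc (0 : ℝ) 1 := ⟨hs.le, hs1⟩
  set G : Finset K → ℝ := fun R => s ^ R.card * bernSum (edgesIn Finset.univ) (fun _ => ρ)
        (fun B => ind (EdgeClosed B R) * greenWeight q s Rᶜ B) with hG
  have hG0 : ∀ R, 0 ≤ G R := fun R => mul_nonneg (pow_nonneg hs.le _)
    (bernSum_nonneg (fun _ => hρ) fun B _ =>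
      mul_nonneg (ind_nonneg _) (greenWeight_nonneg hq hs' _ _))
  -- `G R` is the total weight of the red set being `R`.
  have hZ : compPartition K q s ρ = ∑ R, G R := by
    simp only [hG, ← bernSum_const_mul]
    rw [← bernSum_sum, compPartition]
    refine bernSum_congr fun B _ => ?_
    have := prod_compWeight_mul_bernSum hq hs.le B (fun _ => 1)
    rw [bernSum_const, mul_one] at this
    rw [this]
    exact Finset.sum_congr rfl fun R _ => by ring
  have hS : ∀ S ∈ (Finset.univ : Finset K).powersetCard k,
      bernSum (edgesIn Finset.univ) (fun _ => ρ)
        (fun B => ind (S ∈ comps B) * ∏ D ∈ comps B, compWeight q s D.card) ≤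
      q * (s ^ k)⁻¹ * M * ∑ R : Finset K, ind (S ⊆ R ∧ (R.card : ℝ) ≤ m + k) *
        (compProb ρ R S * G R) := fun S hS => by
    have hSk := (Finset.mem_powersetCard.1 hS).2
    refine (bernSum_mono (fun _ => hρ) fun B _ =>
      ind_mem_comps_mul_le hq hs hs1 hm hM hMm B S).trans (le_of_eq ?_)
    rw [bernSum_const_mul, bernSum_sum, hSk]
    congr 1
    refine Finset.sum_congr rfl fun R _ => ?_
    rw [bernSum_const_mul]
    by_cases hSR : S ⊆ R
    · rw [bernSum_const_mul, bernSum_mem_comps_mul q s ρ hSR]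
      ring
    · rw [ind_neg fun h => hSR h.1, zero_mul, zero_mul]
  refine (Finset.sum_le_sum hS).trans ?_
  rw [← Finset.mul_sum, mul_assoc _ b]
  refine mul_le_mul_of_nonneg_left ?_
    (mul_nonneg (mul_nonneg (by linarith) (by positivity)) hM.le)
  rw [Finset.sum_comm, hZ, Finset.mul_sum]
  refine Finset.sum_le_sum fun R _ => ?_
  by_cases hR : (R.card : ℝ) ≤ m + k
  · refine le_trans ?_ (mul_le_mul_of_nonneg_right (hb R hR) (hG0 R))
    rw [Finset.sum_mul]
    have hsub : R.powersetCard k ⊆ (Finset.univ : Finset K).powersetCard k :=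
      Finset.powersetCard_mono (Finset.subset_univ R)
    rw [← Finset.sum_subset hsub]
    · exact Finset.sum_le_sum fun S _ => mul_le_of_le_one_left
        (mul_nonneg (compProb_nonneg hρ _ _) (hG0 R)) (ind_le_one _)
    · intro S hS hSR
      rw [ind_neg, zero_mul]
      exact fun h => hSR (Finset.mem_powersetCard.2 ⟨h.1, (Finset.mem_powersetCard.1 hS).2⟩)
  · rw [Finset.sum_eq_zero fun S _ => by rw [ind_neg fun h => hR h.2, zero_mul]]
    exact mul_nonneg hb0 (hG0 R)

end random_graph

/-! ### Configurations of the gadget -/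

section gadget

set_option linter.unusedSectionVars false

variable {K T : Type*} [Fintype K] [Fintype T] [DecidableEq K] [DecidableEq T]

/-- The edge joining a vertex of `K` to a terminal. -/
def crossEdge (K T : Type*) : K × T ↪ Sym2 (K ⊕ T) :=
  ⟨fun a => s(Sum.inl a.1, Sum.inr a.2), fun a b h => by
    rcases Sym2.eq_iff.1 h with h | h
    · exact Prod.ext (Sum.inl_injective h.1) (Sum.inr_injective h.2)
    · exact absurd h.1 (by simp)⟩

/-- The configuration with edges `B` inside `K`, edges `C` between `K` and `T`, and all edges
inside `T`. -/
def config (B : Finset (Sym2 K)) (C : Finset (K × T)) : Finset (Sym2 (K ⊕ T)) :=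
  B.map Function.Embedding.inl.sym2Map ∪
    (C.map (crossEdge K T) ∪ (edgesIn Finset.univ).map Function.Embedding.inr.sym2Map)

theorem inl_inl_mem_map {B : Finset (Sym2 K)} {x y : K} :
    s((Sum.inl x : K ⊕ T), Sum.inl y) ∈ B.map Function.Embedding.inl.sym2Map ↔ s(x, y) ∈ B :=
  Finset.mem_map' Function.Embedding.inl.sym2Map (a := s(x, y))

theorem inr_inr_mem_map {B : Finset (Sym2 T)} {x y : T} :
    s((Sum.inr x : K ⊕ T), Sum.inr y) ∈ B.map Function.Embedding.inr.sym2Map ↔ s(x, y) ∈ B :=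
  Finset.mem_map' Function.Embedding.inr.sym2Map (a := s(x, y))

theorem inl_inr_mem_map {C : Finset (K × T)} {x : K} {τ : T} :
    s(Sum.inl x, Sum.inr τ) ∈ C.map (crossEdge K T) ↔ (x, τ) ∈ C :=
  Finset.mem_map' (crossEdge K T) (a := (x, τ))

theorem inr_notMem_map_inl {B : Finset (Sym2 K)} {τ : T} {v : K ⊕ T} :
    s(Sum.inr τ, v) ∉ B.map Function.Embedding.inl.sym2Map := fun h => by
  obtain ⟨e, -, he⟩ := Finset.mem_map.1 h
  induction e with
  | _ a b => simp [Function.Embedding.sym2Map] at he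

theorem inl_notMem_map_inr {B : Finset (Sym2 T)} {x : K} {v : K ⊕ T} :
    s(Sum.inl x, v) ∉ B.map Function.Embedding.inr.sym2Map := fun h => by
  obtain ⟨e, -, he⟩ := Finset.mem_map.1 h
  induction e with
  | _ a b => simp [Function.Embedding.sym2Map] at he

theorem inl_inl_notMem_map_cross {C : Finset (K × T)} {x y : K} :
    s(Sum.inl x, Sum.inl y) ∉ C.map (crossEdge K T) := fun h => by
  obtain ⟨e, -, he⟩ := Finset.mem_map.1 h
  rcases Sym2.eq_iff.1 (show s(_, _) = s(_, _) from he) with h | h <;> simp at h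

theorem inr_inr_notMem_map_cross {C : Finset (K × T)} {x y : T} :
    s(Sum.inr x, Sum.inr y) ∉ C.map (crossEdge K T) := fun h => by
  obtain ⟨e, -, he⟩ := Finset.mem_map.1 h
  rcases Sym2.eq_iff.1 (show s(_, _) = s(_, _) from he) with h | h <;> simp at h

theorem inl_inl_mem_config {B : Finset (Sym2 K)} {C : Finset (K × T)} {x y : K} :
    s(Sum.inl x, Sum.inl y) ∈ config B C ↔ s(x, y) ∈ B := by
  simp only [config, Finset.mem_union, inl_inl_mem_map, inl_inl_notMem_map_cross,
    inl_notMem_map_inr, or_false]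

theorem inl_inr_mem_config {B : Finset (Sym2 K)} {C : Finset (K × T)} {x : K} {τ : T} :
    s(Sum.inl x, Sum.inr τ) ∈ config B C ↔ (x, τ) ∈ C := by
  have : s((Sum.inl x : K ⊕ T), Sum.inr τ) ∉ B.map Function.Embedding.inl.sym2Map := by
    rw [Sym2.eq_swap]; exact inr_notMem_map_inl
  simp only [config, Finset.mem_union, inl_inr_mem_map, this, inl_notMem_map_inr, or_false,
    false_or]

theorem inr_inr_mem_config {B : Finset (Sym2 K)} {C : Finset (K × T)} {τ τ' : T} :
    s(Sum.inr τ, Sum.inr τ') ∈ config B C ↔ τ ≠ τ' := by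
  simp only [config, Finset.mem_union, inr_inr_mem_map, inr_inr_notMem_map_cross,
    inr_notMem_map_inl, false_or, mk_mem_edgesIn, Finset.mem_univ, true_and]

theorem edges_top_eq :
    edges (⊤ : SimpleGraph (K ⊕ T)) =
      (edgesIn Finset.univ).map Function.Embedding.inl.sym2Map ∪
        ((Finset.univ : Finset (K × T)).map (crossEdge K T) ∪
          (edgesIn Finset.univ).map Function.Embedding.inr.sym2Map) := by
  change _ = config (edgesIn Finset.univ) Finset.univ
  ext e
  induction e with
  | _ v w =>
    have h : s(v, w) ∈ edges (⊤ : SimpleGraph (K ⊕ T)) ↔ v ≠ w := by simp [edges]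
    rw [h]
    rcases v with x | τ <;> rcases w with y | τ'
    · simp [inl_inl_mem_config, mk_mem_edgesIn]
    · simp [inl_inr_mem_config]
    · rw [Sym2.eq_swap, inl_inr_mem_config]; simp
    · simp [inr_inr_mem_config]

/-- Sums over the configurations of the gadget, as iterated expectations. -/
theorem bernSum_edges_top (ρ : ℝ) (φ : Finset (Sym2 (K ⊕ T)) → ℝ) :
    bernSum (edges (⊤ : SimpleGraph (K ⊕ T))) (gadgetP K T ρ) φ =
      bernSum (edgesIn Finset.univ) (fun _ => ρ) (fun B =>
        bernSum Finset.univ (fun _ => (Fintype.card K : ℝ) ^ (-(3 / 4) : ℝ))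
          (fun C => φ (config B C))) := by
  have hd2 : Disjoint ((Finset.univ : Finset (K × T)).map (crossEdge K T))
      ((edgesIn (Finset.univ : Finset T)).map Function.Embedding.inr.sym2Map) := by
    rw [Finset.disjoint_left]
    rintro e he
    obtain ⟨⟨x, τ⟩, -, rfl⟩ := Finset.mem_map.1 he
    exact inl_notMem_map_inr
  have hd1 : Disjoint ((edgesIn (Finset.univ : Finset K)).map Function.Embedding.inl.sym2Map)
      ((Finset.univ : Finset (K × T)).map (crossEdge K T) ∪
          (edgesIn Finset.univ).map Function.Embedding.inr.sym2Map) := by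
    rw [Finset.disjoint_right]
    intro e he
    rcases Finset.mem_union.1 he with he | he
    · obtain ⟨⟨x, τ⟩, -, rfl⟩ := Finset.mem_map.1 he
      change s(Sum.inl x, Sum.inr τ) ∉ _
      rw [Sym2.eq_swap]; exact inr_notMem_map_inl
    · obtain ⟨e, -, rfl⟩ := Finset.mem_map.1 he
      induction e with
      | _ a b => exact inr_notMem_map_inl
  rw [edges_top_eq, bernSum_union hd1, bernSum_map]
  rw [bernSum_congr_prob (p' := fun _ => ρ) fun e _ => by
    induction e with
    | _ a b => rfl]
  refine bernSum_congr fun B _ => ?_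
  rw [bernSum_union hd2, bernSum_map]
  rw [bernSum_congr_prob (p' := fun _ => (Fintype.card K : ℝ) ^ (-(3 / 4) : ℝ)) fun e _ => rfl]
  refine bernSum_congr fun C _ => ?_
  rw [bernSum_one]
  · rfl
  · intro e he
    obtain ⟨e, -, rfl⟩ := Finset.mem_map.1 he
    induction e with
    | _ a b => rfl

theorem rcPr_eq_div (q ρ : ℝ) (S : Finset (Sym2 (K ⊕ T)) → Prop) :
    rcPr (⊤ : SimpleGraph (K ⊕ T)) q (gadgetP K T ρ) S =
      bernSum (edges (⊤ : SimpleGraph (K ⊕ T))) (gadgetP K T ρ)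
          (fun A => ind (S A) * q ^ numComponents A) /
        bernSum (edges (⊤ : SimpleGraph (K ⊕ T))) (gadgetP K T ρ)
          (fun A => q ^ numComponents A) := by
  have hw : ∀ A, rcWeight (⊤ : SimpleGraph (K ⊕ T)) q (gadgetP K T ρ) A =
      (∏ e ∈ A, gadgetP K T ρ e) * (∏ e ∈ edges ⊤ \ A, (1 - gadgetP K T ρ e)) *
        q ^ numComponents A := fun A => by
    unfold rcWeight
    rw [mul_assoc, mul_comm]
    congr!
  unfold rcPr rcProb rcPartition bernSum
  rw [← Finset.sum_div, Finset.sum_filter]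
  congr 1
  · refine Finset.sum_congr rfl fun A _ => ?_
    rw [hw]
    beta_reduce
    by_cases h : S A
    · rw [if_pos h, ind_pos h, one_mul]
    · rw [if_neg h, ind_neg h, zero_mul, mul_zero]
  · exact Finset.sum_congr rfl fun A _ => hw A

/-! ### Components of a configuration -/

/-- The factor `q` if no edge of `C` meets `D`, and `1` otherwise. -/
noncomputable def attachWeight (q : ℝ) (D : Finset K) (C : Finset (K × T)) : ℝ :=
  1 + (q - 1) * ind (Disjoint C (D ×ˢ Finset.univ))

theorem reachable_const {V α : Type*} {G : SimpleGraph V} {L : V → α}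
    (h : ∀ v w, G.Adj v w → L v = L w) {v w : V} (hvw : G.Reachable v w) : L v = L w := by
  obtain ⟨p⟩ := hvw
  induction p with
  | nil => rfl
  | cons hadj _ ih => exact (h _ _ hadj).trans ih

theorem Linked.reachable {B : Finset (Sym2 K)} {V : Type*} {G : SimpleGraph V} {ι : K → V}
    (h : ∀ x y, s(x, y) ∈ B → G.Reachable (ι x) (ι y)) {x y : K} (hxy : Linked B x y) :
    G.Reachable (ι x) (ι y) := by
  induction hxy with
  | refl => rfl
  | tail _ hyz ih => exact ih.trans (h _ _ hyz)

theorem numComponents_config [Nonempty T] (B : Finset (Sym2 K)) (C : Finset (K × T)) :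
    numComponents (config B C) =
      1 + {D ∈ comps B | Disjoint C (D ×ˢ (Finset.univ : Finset T))}.card := by
  set G := SimpleGraph.fromEdgeSet (config B C : Set (Sym2 (K ⊕ T))) with hG
  have hadj : ∀ v w, G.Adj v w ↔ s(v, w) ∈ config B C ∧ v ≠ w := fun v w => by simp [hG]
  -- A complete invariant of connected components: `none` for the one containing all terminals,
  -- `some D` for a component `D` of `B` with no edge to `T`.
  set L : K ⊕ T → Option (Finset K) := Sum.elim
    (fun x => if Disjoint C (compOf B x ×ˢ (Finset.univ : Finset T)) then some (compOf B x)
      else none) (fun _ => none) with hL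
  have hLl : ∀ x, L (Sum.inl x) = if Disjoint C (compOf B x ×ˢ (Finset.univ : Finset T)) then
    some (compOf B x) else none := fun x => rfl
  have hLr : ∀ τ, L (Sum.inr τ) = none := fun τ => rfl
  have hcross : ∀ x τ, (x, τ) ∈ C → L (Sum.inl x) = none := fun x τ h => by
    rw [hLl, if_neg]
    exact fun hd => Finset.disjoint_left.1 hd h
      (Finset.mem_product.2 ⟨self_mem_compOf B x, Finset.mem_univ _⟩)
  have hstep : ∀ v w, G.Adj v w → L v = L w := by
    intro v w h
    have h := ((hadj v w).1 h).1
    rcases v with x | τ <;> rcases w with y | τ'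
    · rw [inl_inl_mem_config] at h
      rw [hLl, hLl, compOf_eq_of_linked (Relation.ReflTransGen.single h : Linked B x y)]
    · rw [inl_inr_mem_config] at h
      rw [hLr, hcross x τ' h]
    · rw [Sym2.eq_swap, inl_inr_mem_config] at h
      rw [hLr, hcross y τ h]
    · rfl
  have hlink : ∀ x y, Linked B x y → G.Reachable (Sum.inl x) (Sum.inl y) := fun x y h =>
    Linked.reachable (fun x y hxy => by
      by_cases hne : x = y
      · rw [hne]
      · exact SimpleGraph.Adj.reachable ((hadj _ _).2 ⟨inl_inl_mem_config.2 hxy, by simpa⟩)) h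
  have hTT : ∀ τ τ' : T, G.Reachable (Sum.inr τ) (Sum.inr τ') := fun τ τ' => by
    by_cases hne : τ = τ'
    · rw [hne]
    · exact SimpleGraph.Adj.reachable ((hadj _ _).2 ⟨inr_inr_mem_config.2 hne, by simpa⟩)
  have hnone : ∀ v, L v = none → ∀ τ, G.Reachable v (Sum.inr τ) := by
    rintro (x | τ') hv τ
    · rw [hLl] at hv
      have hd : ¬ Disjoint C (compOf B x ×ˢ (Finset.univ : Finset T)) := fun h => by
        simp [h] at hv
      obtain ⟨⟨y, τ'⟩, hC, hy⟩ := Finset.not_disjoint_iff.1 hd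
      have hxy := mem_compOf.1 (Finset.mem_product.1 hy).1
      refine (hlink x y hxy).trans (SimpleGraph.Reachable.trans ?_ (hTT τ' τ))
      exact SimpleGraph.Adj.reachable ((hadj _ _).2 ⟨inl_inr_mem_config.2 hC, by simp⟩)
    · exact hTT _ _
  have hsome : ∀ v D, L v = some D → ∃ x, v = Sum.inl x ∧ compOf B x = D ∧
      Disjoint C (compOf B x ×ˢ (Finset.univ : Finset T)) := by
    rintro (x | τ') D hv
    · rw [hLl] at hv
      split_ifs at hv with hd
      exact ⟨x, rfl, by simpa using hv, hd⟩
    · simp [hLr] at hv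
  have hreach : ∀ v w, L v = L w → G.Reachable v w := by
    intro v w h
    cases hv : L v with
    | none =>
      obtain ⟨τ⟩ := ‹Nonempty T›
      exact (hnone v hv τ).trans (hnone w (h ▸ hv) τ).symm
    | some D =>
      obtain ⟨x, rfl, hx, -⟩ := hsome v D hv
      obtain ⟨y, rfl, hy, -⟩ := hsome w D (h ▸ hv)
      refine hlink x y (mem_compOf.1 ?_)
      rw [hx, ← hy]
      exact self_mem_compOf B y
  set f : G.ConnectedComponent → Option (Finset K) :=
    fun c => c.lift L (fun v w p _ => reachable_const hstep ⟨p⟩) with hf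
  have hfinj : Function.Injective f := by
    intro c d
    induction c using SimpleGraph.ConnectedComponent.ind with | _ v =>
    induction d using SimpleGraph.ConnectedComponent.ind with | _ w =>
    intro h
    exact SimpleGraph.ConnectedComponent.sound (hreach v w h)
  have hrange : Set.range f = ((insert none
      ({D ∈ comps B | Disjoint C (D ×ˢ (Finset.univ : Finset T))}.image some) :
        Finset (Option (Finset K))) : Set (Option (Finset K))) := by
    ext o
    rw [Finset.mem_coe, Finset.mem_insert, Finset.mem_image]
    constructor
    · rintro ⟨c, rfl⟩
      induction c using SimpleGraph.ConnectedComponent.ind with | _ v =>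
      change L v = none ∨ _
      cases hv : L v with
      | none => exact Or.inl rfl
      | some D =>
        obtain ⟨x, rfl, hx, hd⟩ := hsome v D hv
        exact Or.inr ⟨D, Finset.mem_filter.2 ⟨hx ▸ compOf_mem_comps B x, hx ▸ hd⟩, hv.symm⟩
    · rintro (rfl | ⟨D, hD, rfl⟩)
      · obtain ⟨τ⟩ := ‹Nonempty T›
        exact ⟨G.connectedComponentMk (Sum.inr τ), rfl⟩
      · obtain ⟨hD, hd⟩ := Finset.mem_filter.1 hD
        obtain ⟨x, -, rfl⟩ := Finset.mem_image.1 hD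
        exact ⟨G.connectedComponentMk (Sum.inl x), if_pos hd⟩
  rw [numComponents, ← Nat.card_range_of_injective hfinj, hrange, Nat.card_coe_set_eq,
    Set.ncard_coe_finset, Finset.card_insert_of_notMem (by simp),
    Finset.card_image_of_injective _ (Option.some_injective _), add_comm]

theorem pow_numComponents_config [Nonempty T] (q : ℝ) (B : Finset (Sym2 K))
    (C : Finset (K × T)) :
    q ^ numComponents (config B C) = q * ∏ D ∈ comps B, attachWeight q D C := by
  rw [numComponents_config, pow_add, pow_one, Finset.card_filter, ← Finset.prod_pow_eq_pow_sum]
  congr 1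
  refine Finset.prod_congr rfl fun D _ => ?_
  unfold attachWeight ind
  split_ifs <;> simp

/-! ### When `Y` takes an extreme value -/

theorem gadgetY_config_le_one {B : Finset (Sym2 K)} {C : Finset (K × T)} {D : Finset K}
    (hD : D ∈ comps B) (h : ∀ τ : T, ¬ Disjoint C (D ×ˢ {τ})) :
    gadgetY (config B C) ≤ 1 := by
  unfold gadgetY
  set G := SimpleGraph.fromEdgeSet ((config B C : Set (Sym2 (K ⊕ T))) \ terminalPairs K T) with hG
  obtain ⟨x₀, hx₀⟩ := comps_nonempty hD
  have hl : ∀ (x : K) (v : K ⊕ T), s(Sum.inl x, v) ∉ terminalPairs K T := by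
    rintro x v ⟨a, b, -, hab⟩
    simp at hab
  have hadj : ∀ x v, s(Sum.inl x, v) ∈ config B C → Sum.inl x ≠ v → G.Adj (Sum.inl x) v :=
    fun x v h hne => (SimpleGraph.fromEdgeSet_adj _).2 ⟨⟨h, hl x v⟩, hne⟩
  have key : ∀ τ : T, G.Reachable (Sum.inl x₀) (Sum.inr τ) := fun τ => by
    obtain ⟨⟨y, τ'⟩, hC, hy⟩ := Finset.not_disjoint_iff.1 (h τ)
    rw [Finset.mem_product, Finset.mem_singleton] at hy
    obtain ⟨hy, rfl⟩ := hy
    rw [eq_compOf hD hx₀] at hy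
    refine (Linked.reachable (G := G) (ι := Sum.inl) (fun x y hxy => ?_)
      (mem_compOf.1 hy)).trans (SimpleGraph.Adj.reachable
        (hadj y _ (inl_inr_mem_config.2 hC) (by simp)))
    by_cases hne : x = y
    · rw [hne]
    · exact SimpleGraph.Adj.reachable (hadj _ _ (inl_inl_mem_config.2 hxy) (by simpa))
  rw [Set.ncard_le_one_iff]
  rintro c d ⟨τ, hτ⟩ ⟨τ', hτ'⟩
  rw [SimpleGraph.ConnectedComponent.mem_supp_iff] at hτ hτ'
  rw [← hτ, ← hτ']
  exact SimpleGraph.ConnectedComponent.sound ((key τ).symm.trans (key τ'))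

/-- If no component of `B` attaches to two terminals, then no two terminals are joined without edges
inside `T`. The set of terminals attached to a vertex's component is constant along edges and
separates the terminals. -/
theorem card_le_gadgetY_config {B : Finset (Sym2 K)} {C : Finset (K × T)}
    (h : ∀ x y τ τ', Linked B x y → (x, τ) ∈ C → (y, τ') ∈ C → τ = τ') :
    Fintype.card T ≤ gadgetY (config B C) := by
  unfold gadgetY
  set G := SimpleGraph.fromEdgeSet ((config B C : Set (Sym2 (K ⊕ T))) \ terminalPairs K T) with hG
  set L : K ⊕ T → Set T := Sum.elim (fun x => {τ | ∃ y, Linked B x y ∧ (y, τ) ∈ C})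
    (fun τ => {τ}) with hL
  have hcross : ∀ x τ, (x, τ) ∈ C → L (Sum.inl x) = {τ} := fun x τ hx => by
    ext τ'
    constructor
    · rintro ⟨y, hxy, hy⟩
      exact (h x y τ τ' hxy hx hy).symm
    · rintro rfl
      exact ⟨x, Relation.ReflTransGen.refl, hx⟩
  have hstep : ∀ v w, G.Adj v w → L v = L w := by
    intro v w hvw
    obtain ⟨⟨hm, hnt⟩, hne⟩ := (SimpleGraph.fromEdgeSet_adj _).1 hvw
    have hm : s(v, w) ∈ config B C := hm
    rcases v with x | τ <;> rcases w with y | τ'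
    · rw [inl_inl_mem_config] at hm
      have hxy : Linked B x y := Relation.ReflTransGen.single hm
      ext τ
      exact ⟨fun ⟨z, hz, hC⟩ => ⟨z, hxy.symm.trans hz, hC⟩,
        fun ⟨z, hz, hC⟩ => ⟨z, hxy.trans hz, hC⟩⟩
    · rw [inl_inr_mem_config] at hm
      exact hcross x τ' hm
    · rw [Sym2.eq_swap, inl_inr_mem_config] at hm
      exact (hcross y τ hm).symm
    · exact absurd ⟨τ, τ', fun h => hne (by rw [h]), rfl⟩ hnt
  rw [← Nat.card_eq_fintype_card, ← Set.ncard_univ]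
  refine Set.ncard_le_ncard_of_injOn (fun τ => G.connectedComponentMk (Sum.inr τ))
    (fun τ _ => ⟨τ, rfl⟩) (fun τ _ τ' _ hττ' => ?_)
  have := reachable_const hstep (SimpleGraph.ConnectedComponent.exact hττ')
  exact Set.singleton_injective this

/-! ### Estimates for the edges between `K` and `T` -/

theorem one_le_attachWeight {q : ℝ} (hq : 1 ≤ q) (D : Finset K) (C : Finset (K × T)) :
    1 ≤ attachWeight q D C := by
  have := mul_nonneg (sub_nonneg.2 hq) (ind_nonneg (Disjoint C (D ×ˢ (Finset.univ : Finset T))))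
  unfold attachWeight
  linarith

theorem attachWeight_le {q : ℝ} (hq : 1 ≤ q) (D : Finset K) (C : Finset (K × T)) :
    attachWeight q D C ≤ q := by
  have := mul_le_mul_of_nonneg_left
    (ind_le_one (Disjoint C (D ×ˢ (Finset.univ : Finset T)))) (sub_nonneg.2 hq)
  unfold attachWeight
  linarith

/-- The factors use the disjoint edge sets D × T, hence are independent, and `D` misses `T` with
probability (1-c)^(|D| t). -/
theorem bernSum_prod_attachWeight (q c : ℝ) (B : Finset (Sym2 K)) :
    bernSum (Finset.univ : Finset (K × T)) (fun _ => c)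
        (fun C => ∏ D ∈ comps B, attachWeight q D C) =
      ∏ D ∈ comps B, compWeight q ((1 - c) ^ Fintype.card T) D.card := by
  have hdisj : (comps B : Set (Finset K)).PairwiseDisjoint
      (fun D => D ×ˢ (Finset.univ : Finset T)) := fun D hD D' hD' hne => by
    have := comps_pairwiseDisjoint B hD hD' hne
    exact Finset.disjoint_product.2 (Or.inl this)
  have hun : (comps B).biUnion (fun D => D ×ˢ (Finset.univ : Finset T)) = Finset.univ := by
    refine Finset.eq_univ_iff_forall.2 fun a => Finset.mem_biUnion.2
      ⟨_, compOf_mem_comps B a.1, Finset.mem_product.2 ⟨self_mem_compOf B a.1, Finset.mem_univ _⟩⟩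
  have h := bernSum_prod (p := fun _ => c) (comps B) _ hdisj (fun D C => attachWeight q D C)
  rw [hun] at h
  refine Eq.trans (bernSum_congr fun C _ => Finset.prod_congr rfl fun D _ => ?_)
    (h.trans (Finset.prod_congr rfl fun D _ => ?_))
  · unfold attachWeight
    congr 2
    refine ind_congr ?_
    rw [Finset.disjoint_iff_inter_eq_empty, Finset.disjoint_iff_inter_eq_empty,
      Finset.inter_assoc, Finset.inter_self]
  · unfold attachWeight compWeight
    rw [bernSum_add, bernSum_const, bernSum_const_mul, bernSum_disjoint subset_rfl,
      Finset.prod_const, Finset.card_product, Finset.card_univ, mul_comm D.card, pow_mul]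

theorem prod_attachWeight_insert_le {q : ℝ} (hq : 1 ≤ q) (B : Finset (Sym2 K))
    (C : Finset (K × T)) (a : K × T) :
    ∏ D ∈ comps B, attachWeight q D (insert a C) ≤ ∏ D ∈ comps B, attachWeight q D C := by
  refine Finset.prod_le_prod (fun D _ => zero_le_one.trans (one_le_attachWeight hq D _))
    fun D _ => ?_
  have := mul_le_mul_of_nonneg_left (ind_mono fun h :
    Disjoint (insert a C) (D ×ˢ (Finset.univ : Finset T)) =>
      h.mono_left (Finset.subset_insert a C)) (sub_nonneg.2 hq)
  unfold attachWeight
  linarith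

/-- Only the factor of `D₀` changes, and it lies between 1 and q. -/
theorem prod_attachWeight_sdiff_le {q : ℝ} (hq : 1 ≤ q) {B : Finset (Sym2 K)} {D₀ : Finset K}
    (hD₀ : D₀ ∈ comps B) (τ : T) (C : Finset (K × T)) :
    ∏ D ∈ comps B, attachWeight q D (C \ (D₀ ×ˢ {τ})) ≤
      q * ∏ D ∈ comps B, attachWeight q D C := by
  rw [← Finset.mul_prod_erase _ _ hD₀, ← Finset.mul_prod_erase _ _ hD₀, ← mul_assoc]
  have he : ∀ D ∈ (comps B).erase D₀,
      attachWeight q D (C \ (D₀ ×ˢ {τ})) = attachWeight q D C := fun D hD => by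
    unfold attachWeight
    congr 2
    refine ind_congr ⟨fun h => ?_, fun h => h.mono_left Finset.sdiff_subset⟩
    rw [Finset.disjoint_left] at h ⊢
    intro a ha haD
    refine h (Finset.mem_sdiff.2 ⟨ha, fun haD₀ => ?_⟩) haD
    exact Finset.ne_of_mem_erase hD (comps_eq_of_mem (Finset.mem_of_mem_erase hD) hD₀
      (Finset.mem_product.1 haD).1 (Finset.mem_product.1 haD₀).1)
  rw [Finset.prod_congr rfl he]
  refine mul_le_mul_of_nonneg_right ?_
    (Finset.prod_nonneg fun D _ => zero_le_one.trans (one_le_attachWeight hq D _))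
  exact (attachWeight_le hq _ _).trans
    (le_mul_of_one_le_right (by linarith) (one_le_attachWeight hq _ _))

/-- The contribution to the event `1 < Y < t` of a configuration with a large component. -/
theorem bernSum_gadgetY_le_of_large {q c : ℝ} (hq : 1 ≤ q) (hc : c ∈ Set.Icc (0 : ℝ) 1)
    {B : Finset (Sym2 K)} {D₀ : Finset K} (hD₀ : D₀ ∈ comps B) {g : ℕ} (hg : g ≤ D₀.card) :
    bernSum (Finset.univ : Finset (K × T)) (fun _ => c)
        (fun C => ind (1 < gadgetY (config B C) ∧ gadgetY (config B C) < Fintype.card T) *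
          ∏ D ∈ comps B, attachWeight q D C) ≤
      Fintype.card T * (q * (1 - c) ^ g) *
        ∏ D ∈ comps B, compWeight q ((1 - c) ^ Fintype.card T) D.card := by
  have hq0 : 0 ≤ q := zero_le_one.trans hq
  have hp : ∀ a : K × T, (fun _ => c) a ∈ Set.Icc (0 : ℝ) 1 := fun _ => hc
  have hW : ∀ C : Finset (K × T), 0 ≤ ∏ D ∈ comps B, attachWeight q D C := fun C =>
    Finset.prod_nonneg fun D _ => zero_le_one.trans (one_le_attachWeight hq D _)
  have hF := bernSum_prod_attachWeight (T := T) q c B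
  have hF0 := bernSum_nonneg hp (fun C (_ : C ⊆ Finset.univ) => hW C)
  calc _ ≤ bernSum (Finset.univ : Finset (K × T)) (fun _ => c)
        (fun C => ∑ τ : T, ind (Disjoint C (D₀ ×ˢ {τ})) *
          ∏ D ∈ comps B, attachWeight q D C) := by
        refine bernSum_mono hp fun C _ => ?_
        rw [← Finset.sum_mul]
        refine mul_le_mul_of_nonneg_right ?_ (hW C)
        by_cases h : 1 < gadgetY (config B C) ∧ gadgetY (config B C) < Fintype.card T
        · obtain ⟨τ, hτ⟩ : ∃ τ : T, Disjoint C (D₀ ×ˢ {τ}) := by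
            by_contra! hcon
            exact absurd (gadgetY_config_le_one hD₀ hcon) (not_le.2 h.1)
          rw [ind_pos h, ← ind_pos hτ]
          exact Finset.single_le_sum (f := fun τ => ind (Disjoint C (D₀ ×ˢ {τ})))
            (fun _ _ => ind_nonneg _) (Finset.mem_univ τ)
        · rw [ind_neg h]
          exact Finset.sum_nonneg fun _ _ => ind_nonneg _
    _ ≤ ∑ τ : T, q * (1 - c) ^ g *
          ∏ D ∈ comps B, compWeight q ((1 - c) ^ Fintype.card T) D.card := by
        rw [bernSum_sum, ← hF]
        refine Finset.sum_le_sum fun τ _ => ?_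
        have h1 : bernSum (Finset.univ : Finset (K × T)) (fun _ => c)
              (fun C => ind (Disjoint C (D₀ ×ˢ {τ})) * ∏ D ∈ comps B, attachWeight q D C) ≤
            q * (∏ _e ∈ D₀ ×ˢ ({τ} : Finset T), (1 - c)) *
              bernSum (Finset.univ : Finset (K × T)) (fun _ => c)
                (fun C => ∏ D ∈ comps B, attachWeight q D C) :=
          bernSum_disjoint_le hp (Finset.subset_univ _)
            (fun C => prod_attachWeight_sdiff_le hq hD₀ τ C)
        rw [Finset.prod_const, Finset.card_product, Finset.card_singleton, mul_one] at h1
        have h2 : (1 - c) ^ D₀.card ≤ (1 - c) ^ g :=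
          pow_le_pow_of_le_one (sub_nonneg.2 hc.2) (sub_le_self 1 hc.1) hg
        exact h1.trans (mul_le_mul_of_nonneg_right
          (mul_le_mul_of_nonneg_left h2 hq0) hF0)
    _ = _ := by
        rw [Finset.sum_const, Finset.card_univ, nsmul_eq_mul, mul_assoc]
        ring

open Classical in
/-- The contribution to the event `1 < Y < t` of a configuration with small components. -/
theorem bernSum_gadgetY_le_of_small {q c : ℝ} (hq : 1 ≤ q) (hc : c ∈ Set.Icc (0 : ℝ) 1)
    {B : Finset (Sym2 K)} {k : ℕ} (hk : ∀ D ∈ comps B, D.card ≤ k) :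
    bernSum (Finset.univ : Finset (K × T)) (fun _ => c)
        (fun C => ind (1 < gadgetY (config B C) ∧ gadgetY (config B C) < Fintype.card T) *
          ∏ D ∈ comps B, attachWeight q D C) ≤
      (Fintype.card K * k * (Fintype.card T * Fintype.card T) : ℝ) * c ^ 2 *
        ∏ D ∈ comps B, compWeight q ((1 - c) ^ Fintype.card T) D.card := by
  have hp : ∀ a : K × T, (fun _ => c) a ∈ Set.Icc (0 : ℝ) 1 := fun _ => hc
  have hW : ∀ C : Finset (K × T), 0 ≤ ∏ D ∈ comps B, attachWeight q D C := fun C =>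
    Finset.prod_nonneg fun D _ => zero_le_one.trans (one_le_attachWeight hq D _)
  have hF := bernSum_prod_attachWeight (T := T) q c B
  have hF0 := bernSum_nonneg hp (fun C (_ : C ⊆ Finset.univ) => hW C)
  -- The weight decreases in `C`, so requiring two edges costs at least a factor c^2, as for
  -- independent edges.
  have hpair : ∀ a b : K × T, a ≠ b → bernSum (Finset.univ : Finset (K × T)) (fun _ => c)
        (fun C => ind (a ∈ C) * (ind (b ∈ C) * ∏ D ∈ comps B, attachWeight q D C)) ≤
      c ^ 2 * ∏ D ∈ comps B, compWeight q ((1 - c) ^ Fintype.card T) D.card := by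
    intro a b hab
    refine (bernSum_mem_le hp (Finset.mem_univ a) fun C _ => ?_).trans ?_
    · rw [ind_congr (show b ∈ insert a C ↔ b ∈ C by simp [Ne.symm hab])]
      exact mul_le_mul_of_nonneg_left (prod_attachWeight_insert_le hq B C a) (ind_nonneg _)
    · rw [pow_two, mul_assoc, ← hF]
      exact mul_le_mul_of_nonneg_left (bernSum_mem_le hp (Finset.mem_univ b) fun C _ =>
        prod_attachWeight_insert_le hq B C b) hc.1
  -- Two vertices in one component with two distinct terminals. The vertices may coincide; distinct
  -- terminals still give distinct edges.
  set P : Finset ((Σ _ : K, K) × (T × T)) :=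
    ((Finset.univ : Finset K).sigma (compOf B)) ×ˢ
      (Finset.univ.filter fun x : T × T => x.1 ≠ x.2) with hP
  have hPcard : (P.card : ℝ) ≤ Fintype.card K * k * (Fintype.card T * Fintype.card T) := by
    have h1 : (Finset.univ.sigma (compOf B)).card ≤ Fintype.card K * k := by
      rw [Finset.card_sigma, ← smul_eq_mul, ← Finset.card_univ]
      exact Finset.sum_le_card_nsmul _ _ _ fun x _ => hk _ (compOf_mem_comps B x)
    have h2 : (Finset.univ.filter fun x : T × T => x.1 ≠ x.2).card ≤
        Fintype.card T * Fintype.card T := by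
      rw [← Fintype.card_prod]
      exact Finset.card_le_univ _
    rw [hP, Finset.card_product]
    exact_mod_cast Nat.mul_le_mul h1 h2
  calc _ ≤ bernSum (Finset.univ : Finset (K × T)) (fun _ => c)
        (fun C => ∑ x ∈ P, ind ((x.1.1, x.2.1) ∈ C) * (ind ((x.1.2, x.2.2) ∈ C) *
          ∏ D ∈ comps B, attachWeight q D C)) := by
        refine bernSum_mono hp fun C _ => ?_
        simp only [← mul_assoc]
        rw [← Finset.sum_mul]
        refine mul_le_mul_of_nonneg_right ?_ (hW C)
        have hnn : ∀ x ∈ P, 0 ≤ ind ((x.1.1, x.2.1) ∈ C) * ind ((x.1.2, x.2.2) ∈ C) :=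
          fun x _ => mul_nonneg (ind_nonneg _) (ind_nonneg _)
        by_cases h : 1 < gadgetY (config B C) ∧ gadgetY (config B C) < Fintype.card T
        · obtain ⟨x, y, τ, τ', hxy, hx, hy, hne⟩ : ∃ x y τ τ', Linked B x y ∧ (x, τ) ∈ C ∧
              (y, τ') ∈ C ∧ τ ≠ τ' := by
            by_contra! hcon
            exact absurd (card_le_gadgetY_config hcon) (not_le.2 h.2)
          have hmem : ((⟨x, y⟩, (τ, τ')) : (Σ _ : K, K) × (T × T)) ∈ P := by
            simp [hP, mem_compOf, hxy, hne]
          refine le_trans (le_of_eq ?_) (Finset.single_le_sum hnn hmem)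
          rw [ind_pos h, ind_pos hx, ind_pos hy, one_mul]
        · rw [ind_neg h]
          exact Finset.sum_nonneg hnn
    _ ≤ ∑ x ∈ P, c ^ 2 *
          ∏ D ∈ comps B, compWeight q ((1 - c) ^ Fintype.card T) D.card := by
        rw [bernSum_sum]
        refine Finset.sum_le_sum fun x hx => hpair _ _ fun h => ?_
        rw [hP, Finset.mem_product, Finset.mem_filter] at hx
        exact hx.2.2 (Prod.ext_iff.1 h).2
    _ ≤ _ := by
        rw [Finset.sum_const, nsmul_eq_mul, mul_assoc _ (c ^ 2)]
        refine mul_le_mul_of_nonneg_right hPcard (mul_nonneg (sq_nonneg c) ?_)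
        rw [← hF]; exact hF0

/-! ### The case split by component sizes -/

theorem compPartition_pos {q s ρ : ℝ} (hq : 1 ≤ q) (hs : 0 ≤ s) (hρ : ρ ∈ Set.Icc (0 : ℝ) 1) :
    0 < compPartition K q s ρ := by
  refine zero_lt_one.trans_le ?_
  rw [← bernSum_const (E := edgesIn (Finset.univ : Finset K)) (p := fun _ => ρ) (1 : ℝ)]
  refine bernSum_mono (fun _ => hρ) fun B _ => Finset.prod_induction _ (1 ≤ ·) (fun a b ha hb =>
    one_le_mul_of_one_le_of_one_le ha hb) le_rfl fun D _ => ?_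
  have := mul_nonneg (sub_nonneg.2 hq) (pow_nonneg hs D.card)
  unfold compWeight; linarith

/-- Either some component has size at least `g`, or all have size at most `k`, or some size lies
strictly between. The three terms bound these cases; in the last one the event is bounded by the
expected number of such components. -/
theorem rcPr_gadgetY_le [Nonempty T] {q ρ c β : ℝ} {k g : ℕ} (hq : 1 ≤ q)
    (hρ : ρ ∈ Set.Icc (0 : ℝ) 1) (hc : c ∈ Set.Icc (0 : ℝ) 1)
    (hcK : c = (Fintype.card K : ℝ) ^ (-(3 / 4) : ℝ))
    (hβ : ∀ n, k < n → n < g → ∑ S ∈ (Finset.univ : Finset K).powersetCard n,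
        bernSum (edgesIn Finset.univ) (fun _ => ρ) (fun B => ind (S ∈ comps B) *
          ∏ D ∈ comps B, compWeight q ((1 - c) ^ Fintype.card T) D.card) ≤
      β * compPartition K q ((1 - c) ^ Fintype.card T) ρ) :
    rcPr (⊤ : SimpleGraph (K ⊕ T)) q (gadgetP K T ρ)
        (fun A => 1 < gadgetY A ∧ gadgetY A < Fintype.card T) ≤
      Fintype.card T * (q * (1 - c) ^ g) +
        (Fintype.card K * k * (Fintype.card T * Fintype.card T) : ℝ) * c ^ 2 +
        (Finset.Ioo k g).card * β := by
  set s : ℝ := (1 - c) ^ Fintype.card T with hs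
  have hs0 : 0 ≤ s := pow_nonneg (sub_nonneg.2 hc.2) _
  have hq0 : 0 < q := by linarith
  have hp : ∀ a : K × T, (fun _ => c) a ∈ Set.Icc (0 : ℝ) 1 := fun _ => hc
  have hZ := compPartition_pos (K := K) hq hs0 hρ
  set a₁ : ℝ := Fintype.card T * (q * (1 - c) ^ g) with ha₁
  set a₂ : ℝ := (Fintype.card K * k * (Fintype.card T * Fintype.card T) : ℝ) * c ^ 2 with ha₂
  rw [rcPr_eq_div, bernSum_edges_top, bernSum_edges_top, ← hcK]
  simp only [pow_numComponents_config]
  simp only [mul_left_comm _ q, bernSum_const_mul, bernSum_prod_attachWeight, ← hs]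
  -- The component containing `T` contributes a factor `q` above and below.
  rw [mul_div_mul_left _ _ hq0.ne']
  change _ / compPartition K q s ρ ≤ _
  rw [div_le_iff₀ hZ]
  set F : Finset (Sym2 K) → ℝ := fun B => ∏ D ∈ comps B, compWeight q s D.card with hFdef
  have hF0 : ∀ B, 0 ≤ F B := fun B => Finset.prod_nonneg fun D _ => (compWeight_pos hq hs0 _).le
  have ha₁0 : 0 ≤ a₁ := mul_nonneg (Nat.cast_nonneg _)
    (mul_nonneg hq0.le (pow_nonneg (sub_nonneg.2 hc.2) _))
  have ha₂0 : 0 ≤ a₂ := by positivity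
  set Mid : Finset (Sym2 K) → ℝ := fun B => ∑ n ∈ Finset.Ioo k g,
    ∑ S ∈ (Finset.univ : Finset K).powersetCard n, ind (S ∈ comps B) * F B with hMid
  have hMid0 : ∀ B, 0 ≤ Mid B := fun B => Finset.sum_nonneg fun n _ =>
    Finset.sum_nonneg fun S _ => mul_nonneg (ind_nonneg _) (hF0 B)
  have hpt : ∀ B, bernSum (Finset.univ : Finset (K × T)) (fun _ => c)
        (fun C => ind (1 < gadgetY (config B C) ∧ gadgetY (config B C) < Fintype.card T) *
          ∏ D ∈ comps B, attachWeight q D C) ≤ (a₁ + a₂) * F B + Mid B := by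
    intro B
    have h1 := mul_nonneg ha₁0 (hF0 B)
    have h2 := mul_nonneg ha₂0 (hF0 B)
    by_cases hlarge : ∃ D ∈ comps B, g ≤ D.card
    · obtain ⟨D, hD, hg⟩ := hlarge
      have := bernSum_gadgetY_le_of_large (T := T) hq hc hD hg
      linarith [hMid0 B]
    by_cases hsmall : ∀ D ∈ comps B, D.card ≤ k
    · have := bernSum_gadgetY_le_of_small (T := T) hq hc hsmall
      linarith [hMid0 B]
    push Not at hlarge hsmall
    obtain ⟨S, hS, hkS⟩ := hsmall
    have h3 : F B ≤ Mid B := by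
      have hn : S.card ∈ Finset.Ioo k g := Finset.mem_Ioo.2 ⟨hkS, hlarge S hS⟩
      have hSm : S ∈ (Finset.univ : Finset K).powersetCard S.card := by simp
      calc F B = ind (S ∈ comps B) * F B := by rw [ind_pos hS, one_mul]
        _ ≤ ∑ S ∈ (Finset.univ : Finset K).powersetCard S.card, ind (S ∈ comps B) * F B :=
            Finset.single_le_sum (f := fun S => ind (S ∈ comps B) * F B)
              (fun S _ => mul_nonneg (ind_nonneg _) (hF0 B)) hSm
        _ ≤ Mid B := Finset.single_le_sum (f := fun n =>
              ∑ S ∈ (Finset.univ : Finset K).powersetCard n, ind (S ∈ comps B) * F B)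
              (fun n _ => Finset.sum_nonneg fun S _ => mul_nonneg (ind_nonneg _) (hF0 B)) hn
    have h4 : bernSum (Finset.univ : Finset (K × T)) (fun _ => c)
        (fun C => ind (1 < gadgetY (config B C) ∧ gadgetY (config B C) < Fintype.card T) *
          ∏ D ∈ comps B, attachWeight q D C) ≤ F B := by
      rw [hFdef]
      simp only [hs]
      rw [← bernSum_prod_attachWeight]
      refine bernSum_mono hp fun C _ => mul_le_of_le_one_left ?_ (ind_le_one _)
      exact Finset.prod_nonneg fun D _ => zero_le_one.trans (one_le_attachWeight hq D _)
    linarith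
  refine (bernSum_mono (fun _ => hρ) fun B _ => hpt B).trans ?_
  rw [bernSum_add, bernSum_const_mul, add_mul (a₁ + a₂)]
  refine add_le_add (le_refl ((a₁ + a₂) * compPartition K q s ρ)) ?_
  rw [hMid, bernSum_sum, mul_assoc, ← nsmul_eq_mul]
  refine Finset.sum_le_card_nsmul _ _ _ fun n hn => ?_
  rw [bernSum_sum]
  exact hβ n (Finset.mem_Ioo.1 hn).1 (Finset.mem_Ioo.1 hn).2

end gadget

/-! ### Asymptotics -/

/-- With x = q - 1 > 1, the inequality y < sinh y at y = log x reads log x < (x - 1/x)/2, which is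
exactly λ_c < q. -/
theorem gadgetLambda_lt {q : ℝ} (hq : 2 < q) : gadgetLambda q < q := by
  have h1 : 0 < Real.log (q - 1) := Real.log_pos (by linarith)
  have h2 := Real.self_lt_sinh_iff.2 h1
  rw [Real.sinh_log (by linarith)] at h2
  have h3 : lambdaC q < q := by
    unfold lambdaC
    have h4 : 0 < q - 2 := by linarith
    have h5 : 0 < q - 1 := by linarith
    calc 2 * ((q - 1) / (q - 2)) * Real.log (q - 1)
        < 2 * ((q - 1) / (q - 2)) * ((q - 1 - (q - 1)⁻¹) / 2) :=
          mul_lt_mul_of_pos_left h2 (by positivity)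
      _ = q := by field_simp; ring
  unfold gadgetLambda
  linarith

/-- The hypothesis says (1-x)(1+y) ≥ 1, and e^y ≥ 1+y. -/
theorem exp_neg_le_one_sub {x y : ℝ} (hy : 0 ≤ y) (h : x * y ≤ y - x) :
    Real.exp (-y) ≤ 1 - x := by
  rw [Real.exp_neg, inv_le_comm₀ (Real.exp_pos y)]
  · refine le_trans ?_ (Real.add_one_le_exp y)
    rw [inv_le_iff_one_le_mul₀]
    · nlinarith
    · nlinarith
  · nlinarith

section estimates

variable {K : Type*} [Fintype K] [DecidableEq K]

/-- Each of the `k` vertices contributes a factor |R| / ((|R|+d)(1-ρ)^d). The first ratio gains at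
least d/(θN) in the exponent and the non-edges lose at most dl/N; subcriticality, lθ ≤ 1, makes the
gain win. -/
theorem sum_compProb_le_exp {ρ l θ σ : ℝ} {k d : ℕ} (hρ : ρ ∈ Set.Icc (0 : ℝ) 1)
    (hK : 0 < Fintype.card K) (hρl : Real.exp (-(l / Fintype.card K)) ≤ 1 - ρ) (hθ : 0 < θ)
    (hθ1 : θ ≤ 1) (hlθ : l ≤ 1 / θ) (hσ : 0 < σ) (hd : σ / 2 * Fintype.card K ≤ d) (R : Finset K)
    (hR : (R.card : ℝ) + d ≤ θ * Fintype.card K) :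
    ∑ S ∈ R.powersetCard k, compProb ρ R S ≤
      Fintype.card K * Real.exp (-(σ / 2 * (1 / θ - l) * k)) := by
  set N : ℝ := (Fintype.card K : ℝ) with hN
  have hN0 : 0 < N := Nat.cast_pos.2 hK
  have hd0 : (0 : ℝ) < d := lt_of_lt_of_le (by positivity) hd
  have hrd : 0 < (R.card : ℝ) + d := by positivity
  have hle : R.card + d ≤ Fintype.card K := by
    have : (R.card : ℝ) + d ≤ N := hR.trans (mul_le_of_le_one_left hN0.le hθ1)
    rw [hN] at this
    exact_mod_cast this
  have h := sum_compProb_powersetCard_le hρ R k d hle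
  have h1ρ : 0 < 1 - ρ := (Real.exp_pos _).trans_le hρl
  have key : (R.card : ℝ) ≤
      (((R.card : ℝ) + d) * (1 - ρ) ^ d) * Real.exp (-(σ / 2 * (1 / θ - l))) := by
    have e1 : (R.card : ℝ) ≤ ((R.card : ℝ) + d) * Real.exp (-(d / ((R.card : ℝ) + d))) := by
      have := mul_le_mul_of_nonneg_left
        (Real.one_sub_le_exp_neg (d / ((R.card : ℝ) + d))) hrd.le
      rwa [mul_sub, mul_one, mul_div_cancel₀ _ hrd.ne', add_sub_cancel_right] at this
    have e2 : Real.exp (-(d / ((R.card : ℝ) + d))) ≤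
        Real.exp (-(l / N)) ^ d * Real.exp (-(σ / 2 * (1 / θ - l))) := by
      rw [← Real.exp_nat_mul, ← Real.exp_add, Real.exp_le_exp]
      have e3 : (d : ℝ) / (θ * N) ≤ d / ((R.card : ℝ) + d) :=
        div_le_div_of_nonneg_left hd0.le hrd hR
      have e4 : σ / 2 * (1 / θ - l) ≤ d / N * (1 / θ - l) :=
        mul_le_mul_of_nonneg_right ((le_div_iff₀ hN0).2 hd) (sub_nonneg.2 hlθ)
      have e5 : (d : ℝ) / N * (1 / θ - l) = d / (θ * N) - d * (l / N) := by
        field_simp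
      linarith
    calc (R.card : ℝ) ≤ _ := e1
      _ ≤ ((R.card : ℝ) + d) *
          (Real.exp (-(l / N)) ^ d * Real.exp (-(σ / 2 * (1 / θ - l)))) := by gcongr
      _ ≤ ((R.card : ℝ) + d) * ((1 - ρ) ^ d * Real.exp (-(σ / 2 * (1 / θ - l)))) := by gcongr
      _ = _ := by ring
  have hpos : 0 < ((R.card : ℝ) + d) ^ k * (1 - ρ) ^ (k * d) := by positivity
  refine le_of_mul_le_mul_right (h.trans ?_) hpos
  have hk := pow_le_pow_left₀ (Nat.cast_nonneg R.card) key k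
  rw [mul_pow, mul_pow, ← pow_mul, ← Real.exp_nat_mul] at hk
  calc N * (R.card : ℝ) ^ k ≤ N * _ := mul_le_mul_of_nonneg_left hk hN0.le
    _ = _ := by
      rw [mul_comm d k, show (k : ℝ) * -(σ / 2 * (1 / θ - l)) = -(σ / 2 * (1 / θ - l) * k) by ring]
      ring

/-- The expected number of components of size `k` in the weighted graph is exponentially small. -/
theorem sum_bernSum_mem_comps_le_exp {q s ρ l θ σ : ℝ} {k d : ℕ} (hq : 1 ≤ q) (hs : 0 < s)
    (hs1 : s ≤ 1) (hρ : ρ ∈ Set.Icc (0 : ℝ) 1) (hK : 0 < Fintype.card K)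
    (hρl : Real.exp (-(l / Fintype.card K)) ≤ 1 - ρ)
    (hθ1 : θ ≤ 1) (hlθ : l ≤ 1 / θ) (hσ : 0 < σ) (hσθ : 1 / q + 3 * σ = θ)
    (hd : σ / 2 * Fintype.card K ≤ d) (hd' : (d : ℝ) ≤ σ * Fintype.card K)
    (hk : (k : ℝ) ≤ σ * Fintype.card K)
    (hsk : Real.exp (-(σ / 4 * (1 / θ - l))) ≤ s) :
    ∑ S ∈ (Finset.univ : Finset K).powersetCard k,
        bernSum (edgesIn Finset.univ) (fun _ => ρ)
          (fun B => ind (S ∈ comps B) * ∏ D ∈ comps B, compWeight q s D.card) ≤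
      q * ((1 / q + σ) / σ) * Fintype.card K * Real.exp (-(σ / 4 * (1 / θ - l) * k)) *
        compPartition K q s ρ := by
  set N : ℝ := (Fintype.card K : ℝ) with hN
  have hN0 : 0 < N := Nat.cast_pos.2 hK
  have hq0 : 0 < q := by linarith
  have hqi : 0 < 1 / q := by positivity
  have hθ : 0 < θ := by linarith
  -- The mean red size is at most N/q; the slack σN makes Markov's bound positive, and `M` is its
  -- reciprocal.
  have h := sum_bernSum_mem_comps_le (K := K) (m := (1 / q + σ) * N) (M := (1 / q + σ) / σ)
    (k := k) (b := N * Real.exp (-(σ / 2 * (1 / θ - l) * k))) hq hs hs1 hρ (by positivity)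
    (by positivity) ?_ (by positivity) ?_
  · refine h.trans (mul_le_mul_of_nonneg_right ?_ (compPartition_pos hq hs.le hρ).le)
    -- The price of making the component red uses up half of the exponential gain.
    have h1 : (s ^ k)⁻¹ ≤ Real.exp (σ / 4 * (1 / θ - l) * k) := by
      rw [inv_le_comm₀ (pow_pos hs k) (Real.exp_pos _), ← Real.exp_neg]
      refine le_trans (le_of_eq ?_) (pow_le_pow_left₀ (Real.exp_pos _).le hsk k)
      rw [← Real.exp_nat_mul]
      congr 1; ring
    have h2 : Real.exp (σ / 4 * (1 / θ - l) * k) * Real.exp (-(σ / 2 * (1 / θ - l) * k)) =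
        Real.exp (-(σ / 4 * (1 / θ - l) * k)) := by
      rw [← Real.exp_add]; congr 1; ring
    calc q * (s ^ k)⁻¹ * ((1 / q + σ) / σ) * (N * Real.exp (-(σ / 2 * (1 / θ - l) * k)))
        ≤ q * Real.exp (σ / 4 * (1 / θ - l) * k) * ((1 / q + σ) / σ) *
          (N * Real.exp (-(σ / 2 * (1 / θ - l) * k))) := by gcongr
      _ = q * ((1 / q + σ) / σ) * N * (Real.exp (σ / 4 * (1 / θ - l) * k) *
          Real.exp (-(σ / 2 * (1 / θ - l) * k))) := by ring
      _ = _ := by rw [h2]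
  · have : (1 / q + σ) / σ * (1 - N / q / ((1 / q + σ) * N)) = 1 := by
      field_simp; ring
    exact this.ge
  · intro R hR
    refine sum_compProb_le_exp hρ hK hρl hθ hθ1 hlθ hσ hd R ?_
    rw [← hN, ← hσθ]
    -- The three slacks in 3σ: Markov, the component size `k`, and the `d` extra vertices.
    nlinarith

end estimates

/-! ### Choice of scales and constants -/

/-- The bound on the probability of `1 < Y < t` for a gadget with `u ^ 16` vertices in `K`. -/
theorem rcPr_gadgetY_le_of_card_eq {K T : Type*} [Fintype K] [Fintype T] [DecidableEq K]
    [DecidableEq T] [Nonempty T] {q ρ l θ σ u : ℝ} (hq : 1 ≤ q) (hu : 1 ≤ u)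
    (hKu : (Fintype.card K : ℝ) = u ^ 16) (hTu : (Fintype.card T : ℝ) ≤ u)
    (hρ : ρ ∈ Set.Icc (0 : ℝ) 1) (hρl : Real.exp (-(l / u ^ 16)) ≤ 1 - ρ)
    (hθ1 : θ ≤ 1) (hlθ : l < 1 / θ) (hσ : 0 < σ) (hσθ : 1 / q + 3 * σ = θ)
    (hσu : 2 ≤ σ * u) (hγu : 2 ≤ σ / 4 * (1 / θ - l) * u) :
    rcPr (⊤ : SimpleGraph (K ⊕ T)) q (gadgetP K T ρ)
        (fun A => 1 < gadgetY A ∧ gadgetY A < Fintype.card T) ≤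
      u * (q * Real.exp (-(σ * u))) + (u ^ 4)⁻¹ +
        u ^ 16 * (q * ((1 / q + σ) / σ) * u ^ 16 *
          Real.exp (-(σ / 4 * (1 / θ - l) * u))) := by
  have hu0 : 0 < u := by linarith
  have hq0 : 0 < q := by linarith
  have hqi : 0 < 1 / q := by positivity
  set γ : ℝ := σ / 4 * (1 / θ - l) with hγ
  have hγ0 : 0 < γ := mul_pos (by positivity) (sub_pos.2 hlθ)
  have hσ1 : σ ≤ 1 / 3 := by linarith
  have hu2 : 2 ≤ u := by nlinarith
  set c : ℝ := (u ^ 12)⁻¹ with hc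
  have hcK : c = (Fintype.card K : ℝ) ^ (-(3 / 4) : ℝ) := by
    rw [hKu, hc, ← Real.rpow_natCast u 16, ← Real.rpow_mul hu0.le, ← Real.rpow_natCast u 12,
      ← Real.rpow_neg hu0.le]
    norm_num
  have hc0 : 0 < c := by positivity
  have hpow : ∀ n : ℕ, n ≠ 0 → u ≤ u ^ n := fun n hn => le_self_pow₀ hu hn
  have hc2 : c ≤ 1 / 2 := by
    rw [hc, one_div]
    exact inv_anti₀ two_pos (hu2.trans (hpow 12 (by norm_num)))
  have hcI : c ∈ Set.Icc (0 : ℝ) 1 := ⟨hc0.le, by linarith⟩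
  have hK0 : 0 < Fintype.card K := by
    have : (0 : ℝ) < Fintype.card K := by rw [hKu]; positivity
    exact_mod_cast this
  have h1c : 0 < 1 - c := by linarith
  have hexpc : Real.exp (-(2 * c)) ≤ 1 - c := exp_neg_le_one_sub (by positivity) (by nlinarith)
  have hs0 : 0 < (1 - c) ^ Fintype.card T := pow_pos h1c _
  have hs1 : (1 - c) ^ Fintype.card T ≤ 1 := pow_le_one₀ h1c.le (by linarith)
  -- Since tc ≤ u^(-11), `s` is close enough to 1 for the red penalty.
  have hs : Real.exp (-γ) ≤ (1 - c) ^ Fintype.card T := by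
    refine le_trans ?_ (pow_le_pow_left₀ (Real.exp_pos _).le hexpc _)
    rw [← Real.exp_nat_mul, Real.exp_le_exp]
    have h1 : (Fintype.card T : ℝ) * (2 * c) ≤ u * (2 * c) :=
      mul_le_mul_of_nonneg_right hTu (by positivity)
    have h2 : u * (2 * c) = 2 / u ^ 11 := by rw [hc]; field_simp
    have h3 : 2 / u ^ 11 ≤ γ := by
      rw [div_le_iff₀ (by positivity)]
      exact hγu.trans (mul_le_mul_of_nonneg_left (hpow 11 (by norm_num)) hγ0.le)
    linarith
  -- At cutoff u^2 the small case costs u^16 · u^2 · u^2 · u^(-24) = u^(-4), while intermediate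
  -- components still have more than u vertices.
  set k : ℕ := ⌊u ^ 2⌋₊ with hk
  set g : ℕ := ⌈σ * u ^ 16⌉₊ with hg
  have hgK : g ≤ Fintype.card K := by
    rw [hg, Nat.ceil_le, hKu]
    exact mul_le_of_le_one_left (by positivity) (by linarith)
  -- Rounding down loses less than 1, which is at most half of σu^16.
  have hd1 : σ / 2 * Fintype.card K ≤ (⌊σ * u ^ 16⌋₊ : ℝ) := by
    have h1 := Nat.lt_floor_add_one (σ * u ^ 16)
    have h2 : 2 ≤ σ * u ^ 16 :=
      hσu.trans (mul_le_mul_of_nonneg_left (hpow 16 (by norm_num)) hσ.le)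
    rw [hKu]; linarith
  have hd2 : (⌊σ * u ^ 16⌋₊ : ℝ) ≤ σ * Fintype.card K := by
    rw [hKu]; exact Nat.floor_le (by positivity)
  have hmain := rcPr_gadgetY_le (K := K) (T := T) (q := q) (ρ := ρ) (c := c)
    (β := q * ((1 / q + σ) / σ) * u ^ 16 * Real.exp (-(γ * u))) (k := k) (g := g) hq hρ hcI hcK ?_
  · refine hmain.trans (add_le_add (add_le_add ?_ ?_) ?_)
    · refine mul_le_mul hTu (mul_le_mul_of_nonneg_left ?_ hq0.le) (by positivity) hu0.le
      calc (1 - c) ^ g ≤ Real.exp (-c) ^ g :=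
            pow_le_pow_left₀ h1c.le (Real.one_sub_le_exp_neg c) g
        _ ≤ Real.exp (-(σ * u)) := by
            rw [← Real.exp_nat_mul, Real.exp_le_exp]
            have h1 := Nat.le_ceil (σ * u ^ 16)
            have h2 := mul_le_mul_of_nonneg_right h1 hc0.le
            have h3 : σ * u ^ 16 * c = σ * u ^ 4 := by rw [hc]; field_simp
            have h4 := mul_le_mul_of_nonneg_left (hpow 4 (by norm_num)) hσ.le
            rw [h3] at h2
            linarith
    · have h1 : (k : ℝ) ≤ u ^ 2 := Nat.floor_le (by positivity)
      calc (Fintype.card K * k * (Fintype.card T * Fintype.card T) : ℝ) * c ^ 2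
          ≤ (u ^ 16 * u ^ 2 * (u * u)) * c ^ 2 := by rw [hKu]; gcongr
        _ = (u ^ 4)⁻¹ := by rw [hc]; field_simp
    · refine mul_le_mul_of_nonneg_right ?_ (by positivity)
      rw [← hKu, Nat.cast_le, Nat.card_Ioo]
      omega
  · intro n hkn hng
    have hn1 : (n : ℝ) ≤ σ * Fintype.card K := by
      rw [hKu]; exact (Nat.lt_ceil.1 hng).le
    have hn2 : u ≤ n := (hpow 2 (by norm_num)).trans (Nat.lt_of_floor_lt hkn).le
    refine (sum_bernSum_mem_comps_le_exp hq hs0 hs1 hρ hK0 (by rwa [hKu]) hθ1 hlθ.le hσ hσθ hd1 hd2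
      hn1 hs).trans (mul_le_mul_of_nonneg_right ?_ (compPartition_pos hq hs0.le hρ).le)
    rw [hKu]
    refine mul_le_mul_of_nonneg_left ?_ (by positivity)
    rw [Real.exp_le_exp, neg_le_neg_iff]
    exact mul_le_mul_of_nonneg_left hn2 hγ0.le

theorem eventually_error_lt (q M : ℝ) {a b : ℝ} (ha : 0 < a) (hb : 0 < b) :
    ∀ᶠ u : ℝ in Filter.atTop,
      u * (q * Real.exp (-(a * u))) + (u ^ 4)⁻¹ + u ^ 16 * (M * u ^ 16 * Real.exp (-(b * u))) <
        (u ^ 2)⁻¹ := by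
  have key : ∀ (n : ℕ) (b : ℝ), 0 < b → Filter.Tendsto
      (fun u : ℝ => u ^ n * Real.exp (-(b * u))) Filter.atTop (nhds 0) := fun n b hb => by
    have := tendsto_rpow_mul_exp_neg_mul_atTop_nhds_zero n b hb
    simpa only [Real.rpow_natCast, neg_mul] using this
  have h1 := (key 3 a ha).const_mul q
  have h2 : Filter.Tendsto (fun u : ℝ => (u ^ 2)⁻¹) Filter.atTop (nhds 0) :=
    (Filter.tendsto_pow_atTop two_ne_zero).inv_tendsto_atTop
  have h3 := (key 34 b hb).const_mul M
  have h4 := (h1.add h2).add h3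
  simp only [mul_zero, add_zero] at h4
  filter_upwards [h4.eventually_lt_const one_pos, Filter.eventually_gt_atTop 0] with u hu hu0
  have hu2 : 0 < u ^ 2 := by positivity
  rw [← one_div (u ^ 2), lt_div_iff₀ hu2]
  refine lt_of_eq_of_lt ?_ hu
  field_simp

theorem mainTheorem3 (q : ℝ) (hq : 2 < q) :
    ∃ N₀ : ℝ, ∀ (K : Type*) (T : Type*) [Fintype K] [Fintype T] (η ρ : ℝ),
      1 < Fintype.card T → 0 < η → η < 1 →
      max (max ((Fintype.card T : ℝ) ^ 16) (η ^ (-8 : ℤ))) N₀ ≤ (Fintype.card K : ℝ) →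
      ρ ∈ Set.Icc ((Fintype.card K : ℝ) ^ (-3 : ℤ)) (gadgetLambda q / (Fintype.card K : ℝ)) →
      rcPr (⊤ : SimpleGraph (K ⊕ T)) q (gadgetP K T ρ)
        (fun A => 1 < gadgetY A ∧ gadgetY A < Fintype.card T) < η := by
  have hlam := gadgetLambda_lt hq
  -- l > λ leaves room to replace 1-ρ by e^(-l/N); l > 1 ensures θ ≤ 1, so that |R|+d vertices fit
  -- in `K`.
  obtain ⟨l, hl1, hl2⟩ := exists_between (max_lt hlam (show 1 < q by linarith))
  obtain ⟨hl, hl1⟩ := max_lt_iff.1 hl1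
  have hl0 : 0 < l := by linarith
  obtain ⟨θ, hqθ, hθl⟩ := exists_between (one_div_lt_one_div_of_lt hl0 hl2)
  have hθ0 : 0 < θ := lt_trans (by positivity) hqθ
  have hθ1 : θ ≤ 1 := hθl.le.trans ((div_le_one hl0).2 hl1.le)
  have hlθ : l < 1 / θ := (lt_one_div hθ0 hl0).1 hθl
  -- A third of the gap between the red density bound 1/q and the density θ < 1/l.
  set σ : ℝ := (θ - 1 / q) / 3 with hσdef
  have hσ : 0 < σ := by rw [hσdef]; linarith
  have hσθ : 1 / q + 3 * σ = θ := by rw [hσdef]; ring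
  have hγ : 0 < σ / 4 * (1 / θ - l) := mul_pos (by positivity) (sub_pos.2 hlθ)
  have hev := (eventually_error_lt q (q * ((1 / q + σ) / σ)) hσ hγ).and
    ((Filter.eventually_ge_atTop (1 : ℝ)).and
    (((Filter.tendsto_id.const_mul_atTop hσ).eventually_ge_atTop 2).and
    (((Filter.tendsto_id.const_mul_atTop hγ).eventually_ge_atTop 2).and
    (((Filter.tendsto_id.const_mul_atTop (sub_pos.2 hl)).eventually_ge_atTop
      (gadgetLambda q * l)).and (Filter.eventually_ge_atTop (gadgetLambda q))))))
  obtain ⟨u₀, hu₀⟩ := Filter.eventually_atTop.1 hev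
  refine ⟨max u₀ 1 ^ 16, fun K T _ _ η ρ hT hη _ hK hρ => ?_⟩
  classical
  have : Nonempty T := Fintype.card_pos_iff.1 (by omega)
  obtain ⟨hK', hKN⟩ := max_le_iff.1 hK
  obtain ⟨hKT, hKη⟩ := max_le_iff.1 hK'
  set u : ℝ := (Fintype.card K : ℝ) ^ ((16 : ℕ) : ℝ)⁻¹ with hu
  have hu0 : 0 ≤ u := by positivity
  have hKu : (Fintype.card K : ℝ) = u ^ 16 :=
    (Real.rpow_inv_natCast_pow (Nat.cast_nonneg _) (by norm_num)).symm
  rw [hKu] at hKT hKη hKN hρ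
  have huu : max u₀ 1 ≤ u := le_of_pow_le_pow_left₀ (by norm_num) hu0 hKN
  obtain ⟨herr, hu1, hσu, hγu, hlu, hlamu⟩ := hu₀ u ((le_max_left _ _).trans huu)
  have hTu : (Fintype.card T : ℝ) ≤ u := le_of_pow_le_pow_left₀ (by norm_num) hu0 hKT
  -- N ≥ η^(-8) is u^16 ≥ η^(-8), so an error below u^(-2) suffices.
  have hηu : (u ^ 2)⁻¹ ≤ η := by
    rw [inv_le_comm₀ (by positivity) hη]
    refine le_of_pow_le_pow_left₀ (n := 8) (by norm_num) (by positivity) ?_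
    rw [← pow_mul, inv_pow]
    simpa [zpow_neg] using hKη
  have hu16 : u ≤ u ^ 16 := le_self_pow₀ hu1 (by norm_num)
  have hupos : 0 < u ^ 16 := by positivity
  have hρ0 : 0 ≤ ρ := le_trans (by positivity) hρ.1
  have hρ1 : ρ ≤ 1 := hρ.2.trans ((div_le_one hupos).2 (hlamu.trans hu16))
  have hρl : Real.exp (-(l / u ^ 16)) ≤ 1 - ρ := by
    refine exp_neg_le_one_sub (by positivity) ?_
    have h1 : ρ * (l / u ^ 16) ≤ gadgetLambda q / u ^ 16 * (l / u ^ 16) :=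
      mul_le_mul_of_nonneg_right hρ.2 (by positivity)
    have h2 : gadgetLambda q / u ^ 16 * (l / u ^ 16) ≤ (l - gadgetLambda q) / u ^ 16 := by
      rw [div_mul_div_comm, div_le_div_iff₀ (by positivity) hupos, ← mul_assoc]
      refine mul_le_mul_of_nonneg_right (hlu.trans ?_) hupos.le
      exact mul_le_mul_of_nonneg_left hu16 (sub_pos.2 hl).le
    rw [sub_div] at h2
    linarith [hρ.2]
  exact (rcPr_gadgetY_le_of_card_eq (by linarith) hu1 hKu hTu ⟨hρ0, hρ1⟩ hρl hθ1 hlθ hσ hσθ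
    hσu hγu).trans_lt (herr.trans_le hηu)
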